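/- Let $k$ be an algebraically closed field of characteristic different from $2$ and $3$ (for instance $k=\mathbb{C}$), and let $$P(u,v,\alpha,\beta) = -u^2v^2 - \tfrac{9}{8}\,uv\,\alpha\beta + \beta v^3 + \alpha u^3 + \tfrac{27}{16^2}\,\alpha^2\beta^2 .$$ This is the discriminant of the deformed bidouble cover: for every commutative $k$-algebra $A$ and all $u,v,a,b\in A$, if $B=A[z,w]/(z^2-v-aw,\; w^2-u-bz)$ and $\Delta\in A$ denotes the norm from $B$ to $A$ of the different $R=\det\begin{pmatrix}2z&-a\\-b&2w\end{pmatrix}=4zw-ab$, then $\Delta=-16^2\,P(u,v,a^2,b^2)$. Call a curve $\Gamma\subset\mathbb{P}^3$ a cuspidal curve for a surface $X\subset\mathbb{P}^3$ if the section of $X$ by a general plane $H$ has an ordinary cusp at every point of $H\cap\Gamma$ (a double point whose tangent cone is a double line, this line meeting the plane section there with multiplicity exactly $3$). A twisted cubic is a projective transform of the image of $(s:t)\mapsto(s^3:s^2t:st^2:t^3)$. Theorem. The quartic surface $P=\{P(u,v,\alpha,\beta)=0\}\subset\mathbb{P}^3_k$ has the following properties. 1. The form $P$ is homogeneous of degree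 $4$ and irreducible. 2. The singular locus $\Gamma$ of $P$ (as a set of points) is a twisted cubic, and $\Gamma$ is a cuspidal curve for $P$. 3. $P$ is projectively unique: every quartic surface in $\mathbb{P}^3$ that has a twisted cubic as a cuspidal curve is projectively equivalent to $P$. 4. $P$ is the dual surface of a twisted cubic: there is a twisted cubic $D$ in the dual space such that the points of $P$ are exactly the planes tangent to $D$. 5. $P$ is the tangential developable of $\Gamma$, that is, the union of the tangent lines of $\Gamma$. 6. $P$ is the discriminant surface of binary cubic forms: there is a linear isomorphism from $k^4$ to the space of binary cubic forms over $k$ that carries $P$ onto the set of forms with a multiple root in $\mathbb{P}^1$, and under which the form $P$ is a nonzero constant multiple of the discriminant. -/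

import Mathlib

open scoped LinearAlgebra.Projectivization

noncomputable section

namespace CuspidalQuartic

open MvPolynomial

/-! ### The deformed bidouble cover and its discriminant -/

section Cover

variable {A : Type*} [CommRing A]

/-- The ring `B = A[z, w] / (z² - v - a w, w² - u - b z)`, with `z = X 0` and `w = X 1`. -/
abbrev DeformedBidoubleCover (u v a b : A) : Type _ :=
  MvPolynomial (Fin 2) A ⧸
    (Ideal.span {X 0 ^ 2 - C v - C a * X 1, X 1 ^ 2 - C u - C b * X 0} :
      Ideal (MvPolynomial (Fin 2) A))

/-- The different `R = det (2z, -a; -b, 2w)` of `B` over `A`: the class in `B` of the Jacobian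
determinant of the two equations. -/
def different (u v a b : A) : DeformedBidoubleCover u v a b :=
  Ideal.Quotient.mk _ (Matrix.det !![2 * X 0, -C a; -C b, 2 * X 1])

/-- The discriminant `Δ` of `B` over `A`: the norm of the different. -/
def coverDiscriminant (u v a b : A) : A :=
  Algebra.norm A (different u v a b)

end Cover

variable {k : Type*} [Field k]

/-- The quartic form
`P(u,v,α,β) = -u²v² - (9/8) u v α β + β v³ + α u³ + (27/16²) α² β²`, with
`u = X 0`, `v = X 1`, `α = X 2`, `β = X 3`. -/
def quarticP (k : Type*) [Field k] : MvPolynomial (Fin 4) k :=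
  -(X 0 ^ 2 * X 1 ^ 2) - C (9 / 8) * (X 0 * X 1 * X 2 * X 3) + X 3 * X 1 ^ 3 + X 2 * X 0 ^ 3
    + C (27 / 16 ^ 2) * (X 2 ^ 2 * X 3 ^ 2)

/-! ### Surfaces in `ℙ³`, given by a form in four variables -/

/-- The set of points of `ℙ³` at which the form `F` vanishes. -/
def zeroLocus (F : MvPolynomial (Fin 4) k) : Set (ℙ k (Fin 4 → k)) :=
  {x | eval x.rep F = 0}

/-- The singular points of the surface `F = 0`. -/
def singularLocus (F : MvPolynomial (Fin 4) k) : Set (ℙ k (Fin 4 → k)) :=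
  {x | eval x.rep F = 0 ∧ ∀ i, eval x.rep (pderiv i F) = 0}

/-- The surfaces `F = 0` and `G = 0` are projectively equivalent: up to a nonzero constant, `G` is
obtained from `F` by an invertible linear change of coordinates. (Over an infinite field equality
of values is the same as equality of forms.) -/
def ProjectivelyEquivalent (F G : MvPolynomial (Fin 4) k) : Prop :=
  ∃ (g : (Fin 4 → k) ≃ₗ[k] (Fin 4 → k)) (c : k), c ≠ 0 ∧ ∀ x, eval (g x) F = c * eval x G

/-! ### Twisted cubics, tangent lines, tangential developable, dual surface -/

/-- The image of `ℙ¹` under the third Veronese map `(s : t) ↦ (s³ : s²t : st² : t³)`. -/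
def standardTwistedCubic (k : Type*) [Field k] : Set (ℙ k (Fin 4 → k)) :=
  {x | ∃ (s t : k) (h : ![s ^ 3, s ^ 2 * t, s * t ^ 2, t ^ 3] ≠ 0), x = Projectivization.mk k _ h}

/-- A twisted cubic is the image of the standard one under a projective transformation. -/
def IsTwistedCubic (Γ : Set (ℙ k (Fin 4 → k))) : Prop :=
  ∃ g : (Fin 4 → k) ≃ₗ[k] (Fin 4 → k),
    Γ = Projectivization.map g.toLinearMap g.injective '' standardTwistedCubic k

/-- The (affine cone over the) embedded projective tangent space at `y` of a subset `Γ` of `ℙ³`: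
the common kernel of the differentials at `y` of all forms that vanish on `Γ`. -/
def embeddedTangentSpace (Γ : Set (ℙ k (Fin 4 → k))) (y : ℙ k (Fin 4 → k)) : Set (Fin 4 → k) :=
  {w | ∀ (d : ℕ) (f : MvPolynomial (Fin 4) k), f.IsHomogeneous d →
    (∀ z ∈ Γ, eval z.rep f = 0) → ∑ i, w i * eval y.rep (pderiv i f) = 0}

/-- The tangential developable of a smooth curve `Γ`: the union of its tangent lines. -/
def tangentialDevelopable (Γ : Set (ℙ k (Fin 4 → k))) : Set (ℙ k (Fin 4 → k)) :=
  {x | ∃ y ∈ Γ, x.rep ∈ embeddedTangentSpace Γ y}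

/-- The dual surface of a smooth space curve `D`: the set of planes, in dual coordinates, that
are tangent to `D` at some point, i.e. contain a tangent line of `D`. The point `x` is the plane
with equation `∑ xᵢ wᵢ = 0`. -/
def dualSurface (D : Set (ℙ k (Fin 4 → k))) : Set (ℙ k (Fin 4 → k)) :=
  {x | ∃ y ∈ D, ∀ w ∈ embeddedTangentSpace D y, x.rep ⬝ᵥ w = 0}

/-! ### Cusps -/

/-- The plane curve `f = 0` has an ordinary cusp at the origin: it has a double point there whose
tangent cone is a line `ℓ` counted twice, and `ℓ` meets the curve at the origin with
multiplicity exactly three (so `ℓ` does not divide the cubic part of `f`). -/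
def IsOrdinaryCuspAtOrigin (f : MvPolynomial (Fin 2) k) : Prop :=
  homogeneousComponent 0 f = 0 ∧ homogeneousComponent 1 f = 0 ∧
    ∃ l : MvPolynomial (Fin 2) k, l.IsHomogeneous 1 ∧ l ≠ 0 ∧
      (∃ c : k, c ≠ 0 ∧ homogeneousComponent 2 f = C c * l ^ 2) ∧
      ¬ l ∣ homogeneousComponent 3 f

/-- The equation of the surface `F = 0` in the affine chart `(y, z) ↦ p + y q + z r` of the plane
spanned by `p, q, r`, whose origin is the point `p`. -/
def planeChart (F : MvPolynomial (Fin 4) k) (p q r : Fin 4 → k) : MvPolynomial (Fin 2) k :=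
  aeval (fun i => C (p i) + C (q i) * X 0 + C (r i) * X 1) F

/-- The section of the surface `F = 0` by the plane `∑ hᵢ wᵢ = 0` (where `h ≠ 0`) has an ordinary
cusp at the point `x` of that plane. -/
def SectionHasCuspAt (F : MvPolynomial (Fin 4) k) (h : Fin 4 → k) (x : ℙ k (Fin 4 → k)) : Prop :=
  ∃ q r : Fin 4 → k, LinearIndependent k ![x.rep, q, r] ∧
    h ⬝ᵥ x.rep = 0 ∧ h ⬝ᵥ q = 0 ∧ h ⬝ᵥ r = 0 ∧ IsOrdinaryCuspAtOrigin (planeChart F x.rep q r)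

/-- The curve `Γ` is a cuspidal curve for the surface `F = 0`: the section of the surface by a
general plane (one in a nonempty Zariski open subset of the dual space) has an ordinary cusp at
every point where the plane meets `Γ`. -/
def IsCuspidalCurve (F : MvPolynomial (Fin 4) k) (Γ : Set (ℙ k (Fin 4 → k))) : Prop :=
  ∃ (d : ℕ) (Φ : MvPolynomial (Fin 4) k), Φ.IsHomogeneous d ∧ Φ ≠ 0 ∧
    ∀ h : Fin 4 → k, h ≠ 0 → eval h Φ ≠ 0 →
      ∀ x ∈ Γ, h ⬝ᵥ x.rep = 0 → SectionHasCuspAt F h x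

/-! ### Binary cubic forms -/

/-- The four-dimensional space of binary cubic forms. -/
abbrev BinaryCubicForm (k : Type*) [Field k] : Type _ := homogeneousSubmodule (Fin 2) k 3

/-- The coefficients `a, b, c, d` of the form `a s³ + b s² t + c s t² + d t³`. -/
def BinaryCubicForm.toCubic (f : BinaryCubicForm k) : Cubic k where
  a := coeff (Finsupp.single 0 3) f.1
  b := coeff (Finsupp.single 0 2 + Finsupp.single 1 1) f.1
  c := coeff (Finsupp.single 0 1 + Finsupp.single 1 2) f.1
  d := coeff (Finsupp.single 1 3) f.1

/-- The discriminant surface in the projective space of binary cubic forms: the forms that have a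
multiple root in `ℙ¹`, i.e. are divisible by the square of a nonzero linear form. -/
def discriminantSurface (k : Type*) [Field k] : Set (ℙ k (BinaryCubicForm k)) :=
  {f | ∃ l : MvPolynomial (Fin 2) k, l.IsHomogeneous 1 ∧ l ≠ 0 ∧ l ^ 2 ∣ f.rep.1}

end CuspidalQuartic

end

open CuspidalQuartic

/-! With `a = β/4`, `b = u`, `c = v`, `d = α/4`, the form `P` is minus the discriminant of the
binary cubic `a s³ + b s²t + c st² + d t³` (`eval_quarticP`). In binomial coordinates `(x₀, 3x₁,
3x₂, x₃)` the twisted cubic is the curve of cubes of linear forms, its tangent lines consist of the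
products `l²m`, and `P = 27 (Q₁² - 4 Q₀ Q₂)`, where the `Qᵢ` are the quadrics through the curve and,
up to a factor, the coefficients of the Hessian.

So the claims on discriminant, developable and dual surface all reduce to one fact: the discriminant
vanishes exactly when there is a double root (`discr_eq_zero_iff_exists_double_root`). For the dual
surface, a plane restricts to the curve as a binary cubic and is tangent where that cubic has a
double root. The singular locus is `Q₀ = Q₁ = Q₂ = 0`: `P` is quadratic in the `Qᵢ`, and conversely
the partial derivatives of `P` control `Q₀²` and `Q₂²`.

Cusps. In a plane chart at a point of the curve, `Qᵢ = Lᵢ + Nᵢ` with `Lᵢ` linear and `Nᵢ` quadratic,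
so `∑ Mᵢⱼ Qᵢ Qⱼ` has quadratic part `∑ Mᵢⱼ Lᵢ Lⱼ`. At `(1 : t : t² : t³)` the vectors of values of
the `Lᵢ` lie in the plane `v₂ = t v₁ - t² v₀`, which is tangent to the cone `v₁² = 4 v₀ v₂`. Hence
for `P` the quadratic part is a square, cut out by the osculating plane.

Uniqueness reverses this. If a quartic has a cuspidal twisted cubic, its gradient at a point of the
curve is proportional to all planes through that point, hence zero. Comparing coefficients, the
quartic is `∑ Mᵢⱼ Qᵢ Qⱼ` (`exists_eq_quadQuartic`). Double tangent cones make `M` degenerate on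
every tangent plane of the cone `v₁² = 4 v₀ v₂`, so `M` defines that cone or has rank at most one
(`eq_discriminant_or_rank_one`). In the second case the quartic is a constant times the square of a
quadric, and its sections have no ordinary cusps.

The cover needs only a 4 × 4 determinant. Irreducibility holds because `P` is a primitive quadratic
in `β` whose discriminant is not a square. -/

open scoped LinearAlgebra.Projectivization

noncomputable section

namespace CuspidalQuartic

open MvPolynomial

/-! ### The deformed bidouble cover as a free module, and the norm of the different -/

section Cover

variable {A : Type*} [CommRing A]

/-- Multiplication by `z` on the basis `1, z, w, zw` of the deformed bidouble cover. -/
def coverMulZ (u v a b : A) : (Fin 4 → A) →ₗ[A] (Fin 4 → A) :=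
  Matrix.mulVecLin !![0, v, 0, a * u; 1, 0, 0, a * b; 0, a, 0, v; 0, 0, 1, 0]

/-- Multiplication by `w` on the basis `1, z, w, zw` of the deformed bidouble cover. -/
def coverMulW (u v a b : A) : (Fin 4 → A) →ₗ[A] (Fin 4 → A) :=
  Matrix.mulVecLin !![0, 0, u, b * v; 0, 0, b, u; 1, 0, 0, a * b; 0, 1, 0, 0]

lemma coverMulZ_apply (u v a b : A) (x : Fin 4 → A) :
    coverMulZ u v a b x =
      ![v * x 1 + a * u * x 3, x 0 + a * b * x 3, a * x 1 + v * x 3, x 2] := by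
  ext i
  fin_cases i <;> simp [coverMulZ, Matrix.mulVec, dotProduct, Fin.sum_univ_four]

lemma coverMulW_apply (u v a b : A) (x : Fin 4 → A) :
    coverMulW u v a b x =
      ![u * x 2 + b * v * x 3, b * x 2 + u * x 3, x 0 + a * b * x 3, x 1] := by
  ext i
  fin_cases i <;> simp [coverMulW, Matrix.mulVec, dotProduct, Fin.sum_univ_four]

/-- Commutation is what makes the action of `zᵐ wⁿ` compatible with multiplication by `w` as well as
by `z`. -/
lemma coverMul_comm (u v a b : A) (x : Fin 4 → A) :
    coverMulZ u v a b (coverMulW u v a b x) = coverMulW u v a b (coverMulZ u v a b x) := by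
  ext i
  fin_cases i <;> simp [coverMulZ_apply, coverMulW_apply] <;> ring

lemma coverMulW_iterate_comm (u v a b : A) (n : ℕ) (x : Fin 4 → A) :
    coverMulW u v a b ((coverMulZ u v a b ^ n) x) =
      (coverMulZ u v a b ^ n) (coverMulW u v a b x) := by
  induction n generalizing x with
  | zero => simp
  | succ n ih => rw [pow_succ, Module.End.mul_apply, ih, Module.End.mul_apply, coverMul_comm]

/-- The coordinates of the class of a polynomial in the basis `1, z, w, zw`. -/
def coverCoords (u v a b : A) : MvPolynomial (Fin 2) A →ₗ[A] (Fin 4 → A) :=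
  (basisMonomials (Fin 2) A).constr A fun m =>
    (coverMulZ u v a b ^ m 0) ((coverMulW u v a b ^ m 1) ![1, 0, 0, 0])

lemma coverCoords_monomial (u v a b : A) (m : Fin 2 →₀ ℕ) :
    coverCoords u v a b (monomial m 1) =
      (coverMulZ u v a b ^ m 0) ((coverMulW u v a b ^ m 1) ![1, 0, 0, 0]) := by
  exact (basisMonomials (Fin 2) A).constr_basis A _ m

lemma coverCoords_one (u v a b : A) : coverCoords u v a b 1 = ![1, 0, 0, 0] := by
  have := coverCoords_monomial u v a b 0
  simpa using this

lemma coverCoords_X_zero_mul (u v a b : A) (p : MvPolynomial (Fin 2) A) :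
    coverCoords u v a b (X 0 * p) = coverMulZ u v a b (coverCoords u v a b p) := by
  suffices h : coverCoords u v a b ∘ₗ LinearMap.mulLeft A (X 0) =
      coverMulZ u v a b ∘ₗ coverCoords u v a b from LinearMap.congr_fun h p
  refine (basisMonomials (Fin 2) A).ext fun m => ?_
  simp only [coe_basisMonomials, LinearMap.comp_apply, LinearMap.mulLeft_apply]
  rw [X, monomial_mul, one_mul, coverCoords_monomial, coverCoords_monomial]
  simp [pow_add]

lemma coverCoords_X_one_mul (u v a b : A) (p : MvPolynomial (Fin 2) A) :
    coverCoords u v a b (X 1 * p) = coverMulW u v a b (coverCoords u v a b p) := by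
  suffices h : coverCoords u v a b ∘ₗ LinearMap.mulLeft A (X 1) =
      coverMulW u v a b ∘ₗ coverCoords u v a b from LinearMap.congr_fun h p
  refine (basisMonomials (Fin 2) A).ext fun m => ?_
  simp only [coe_basisMonomials, LinearMap.comp_apply, LinearMap.mulLeft_apply]
  rw [X, monomial_mul, one_mul, coverCoords_monomial, coverCoords_monomial,
    coverMulW_iterate_comm]
  simp [pow_add]

lemma coverCoords_C_mul (u v a b c : A) (p : MvPolynomial (Fin 2) A) :
    coverCoords u v a b (C c * p) = c • coverCoords u v a b p := by
  rw [← smul_eq_C_mul, map_smul]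

/-- The ideal of relations of the deformed bidouble cover. -/
abbrev coverIdeal (u v a b : A) : Ideal (MvPolynomial (Fin 2) A) :=
  Ideal.span {X 0 ^ 2 - C v - C a * X 1, X 1 ^ 2 - C u - C b * X 0}

/-- Coordinates intertwine `z` and `w` with the two operators, and these satisfy the defining
relations `Z² = v + aW` and `W² = u + bZ`. -/
lemma coverCoords_eq_zero (u v a b : A) {p : MvPolynomial (Fin 2) A}
    (hp : p ∈ coverIdeal u v a b) : coverCoords u v a b p = 0 := by
  obtain ⟨f, g, rfl⟩ := Ideal.mem_span_pair.1 hp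
  have e : f * (X 0 ^ 2 - C v - C a * X 1) + g * (X 1 ^ 2 - C u - C b * X 0) =
      X 0 * (X 0 * f) - C v * f - C a * (X 1 * f) +
      (X 1 * (X 1 * g) - C u * g - C b * (X 0 * g)) := by ring
  rw [e]
  simp only [map_add, map_sub, coverCoords_X_zero_mul, coverCoords_X_one_mul, coverCoords_C_mul]
  ext i
  fin_cases i <;> simp [coverMulZ_apply, coverMulW_apply, Matrix.vecHead, Matrix.vecTail] <;> ring

/-- The element of the cover with given coordinates in the basis `1, z, w, zw`. -/
def coverPoly : (Fin 4 → A) →ₗ[A] MvPolynomial (Fin 2) A where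
  toFun x := C (x 0) + C (x 1) * X 0 + C (x 2) * X 1 + C (x 3) * (X 0 * X 1)
  map_add' x y := by simp; ring
  map_smul' c x := by simp [smul_eq_C_mul]; ring

lemma coverCoords_coverPoly (u v a b : A) (x : Fin 4 → A) :
    coverCoords u v a b (coverPoly x) = x := by
  have e : coverPoly x = C (x 0) * 1 + C (x 1) * (X 0 * 1) + C (x 2) * (X 1 * 1) +
    C (x 3) * (X 0 * (X 1 * 1)) := by simp [coverPoly]
  rw [e]
  simp only [map_add, coverCoords_X_zero_mul, coverCoords_X_one_mul, coverCoords_C_mul,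
    coverCoords_one]
  ext i
  fin_cases i <;> simp [coverMulZ_apply, coverMulW_apply]

/-- Normal forms are stable, modulo the relations, under multiplication by `z` and by `w`, so by
induction they represent every class. -/
lemma coverPoly_coverCoords (u v a b : A) (p : MvPolynomial (Fin 2) A) :
    (Ideal.Quotient.mk (coverIdeal u v a b)) (coverPoly (coverCoords u v a b p)) =
      Ideal.Quotient.mk _ p := by
  set I := coverIdeal u v a b
  have hz : X 0 ^ 2 - C v - C a * X 1 ∈ I := Ideal.subset_span (by simp)
  have hw : X 1 ^ 2 - C u - C b * X 0 ∈ I := Ideal.subset_span (by simp)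
  induction p using MvPolynomial.induction_on with
  | C c =>
    have : (C c : MvPolynomial (Fin 2) A) = C c * 1 := by simp
    rw [this, coverCoords_C_mul, coverCoords_one]
    simp [coverPoly]
  | add p q hp hq => simp only [map_add, hp, hq]
  | mul_X p i hp =>
    rw [mul_comm p, map_mul (Ideal.Quotient.mk I), ← hp, ← map_mul, Ideal.Quotient.eq]
    set x := coverCoords u v a b p with hx
    fin_cases i
    · simp only [Fin.zero_eta, coverCoords_X_zero_mul, coverMulZ_apply, ← hx]
      -- Reducing `z² w` uses both relations: `z² = v + aw` first, then `w² = u + bz` in the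
      -- resulting term `a w²`.
      have e : coverPoly ![v * x 1 + a * u * x 3, x 0 + a * b * x 3, a * x 1 + v * x 3, x 2] -
          X 0 * coverPoly x = (-(C (x 1) + C (x 3) * X 1)) * (X 0 ^ 2 - C v - C a * X 1) +
            (-(C a * C (x 3))) * (X 1 ^ 2 - C u - C b * X 0) := by
        simp [coverPoly]; ring
      rw [e]
      exact I.add_mem (I.mul_mem_left _ hz) (I.mul_mem_left _ hw)
    · simp only [Fin.mk_one, coverCoords_X_one_mul, coverMulW_apply, ← hx]
      have e : coverPoly ![u * x 2 + b * v * x 3, b * x 2 + u * x 3, x 0 + a * b * x 3, x 1] -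
          X 1 * coverPoly x = (-(C (x 2) + C (x 3) * X 0)) * (X 1 ^ 2 - C u - C b * X 0) +
            (-(C b * C (x 3))) * (X 0 ^ 2 - C v - C a * X 1) := by
        simp [coverPoly]; ring
      rw [e]
      exact I.add_mem (I.mul_mem_left _ hw) (I.mul_mem_left _ hz)

/-- The deformed bidouble cover is free of rank four. -/
def coverEquiv (u v a b : A) : DeformedBidoubleCover u v a b ≃ₗ[A] (Fin 4 → A) :=
  LinearEquiv.ofLinearMap
    (((coverIdeal u v a b).restrictScalars A).liftQ (coverCoords u v a b) fun _ hp =>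
      coverCoords_eq_zero u v a b hp)
    ((Ideal.Quotient.mkₐ A (coverIdeal u v a b)).toLinearMap ∘ₗ coverPoly)
    (LinearMap.ext fun x => coverCoords_coverPoly u v a b x)
    (LinearMap.ext fun y => by
      obtain ⟨p, rfl⟩ := Ideal.Quotient.mk_surjective y
      exact coverPoly_coverCoords u v a b p)

lemma coverEquiv_mk (u v a b : A) (p : MvPolynomial (Fin 2) A) :
    coverEquiv u v a b (Ideal.Quotient.mk _ p) = coverCoords u v a b p := rfl

lemma coverEquiv_different_mul (u v a b : A) (y : DeformedBidoubleCover u v a b) :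
    coverEquiv u v a b (different u v a b * y) =
      4 • coverMulZ u v a b (coverMulW u v a b (coverEquiv u v a b y)) -
        (a * b) • coverEquiv u v a b y := by
  obtain ⟨p, rfl⟩ := Ideal.Quotient.mk_surjective y
  rw [different, ← map_mul, coverEquiv_mk, coverEquiv_mk]
  have e : Matrix.det !![2 * X 0, -C a; -C b, 2 * X 1] * p =
      C 4 * (X 0 * (X 1 * p)) - C (a * b) * p := by
    rw [Matrix.det_fin_two_of, show (C 4 : MvPolynomial (Fin 2) A) = 4 from map_ofNat C 4, C_mul]
    ring
  rw [e]
  simp only [map_sub, coverCoords_X_zero_mul, coverCoords_X_one_mul, coverCoords_C_mul]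
  congr 1
  ext i
  simp

lemma coverDiscriminant_eq (u v a b : A) :
    coverDiscriminant u v a b = 256 * (u ^ 2 * v ^ 2) + 288 * (u * v * (a ^ 2 * b ^ 2)) -
      256 * (b ^ 2 * v ^ 3) - 256 * (a ^ 2 * u ^ 3) - 27 * (a ^ 4 * b ^ 4) := by
  let B := Module.Basis.ofEquivFun (coverEquiv u v a b)
  -- The columns are the coordinates of `4zw - ab` times `1`, `z`, `w`, `zw`.
  have key : LinearMap.toMatrix B B (LinearMap.mulLeft A (different u v a b)) =
      !![-(a * b), 4 * (a * u), 4 * (b * v), 4 * (u * v);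
        0, 3 * (a * b), 4 * u, 4 * (b * v);
        0, 4 * v, 3 * (a * b), 4 * (a * u);
        4, 0, 0, 3 * (a * b)] := by
    ext i j
    have hB : coverEquiv u v a b (B j) = Pi.single j 1 := by
      simp [B, Module.Basis.coe_ofEquivFun]
    rw [LinearMap.toMatrix_apply, LinearMap.mulLeft_apply, Module.Basis.ofEquivFun_repr_apply,
      coverEquiv_different_mul, hB, coverMulW_apply, coverMulZ_apply]
    fin_cases i <;> fin_cases j <;> simp <;> ring
  rw [coverDiscriminant, Algebra.norm_apply, ← LinearMap.det_toMatrix B]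
  change (LinearMap.toMatrix B B (LinearMap.mulLeft A (different u v a b))).det = _
  rw [key]
  simp [Matrix.det_succ_row_zero, Fin.sum_univ_succ, Fin.succAbove]
  ring

end Cover

variable {k : Type*} [Field k]

lemma coverDiscriminant_eq_aeval_quarticP (h2 : (2 : k) ≠ 0) {A : Type*} [CommRing A] [Algebra k A]
    (u v a b : A) :
    coverDiscriminant u v a b = -16 ^ 2 * aeval ![u, v, a ^ 2, b ^ 2] (quarticP k) := by
  -- The factor `256 = 16²` clears the denominators of `9/8` and `27/16²`; here `2 ≠ 0` enters.
  have e1 : (256 : A) * algebraMap k A (9 / 8) = 288 := by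
    rw [← map_ofNat (algebraMap k A) 256, ← map_mul, ← map_ofNat (algebraMap k A) 288]
    congr 1
    have : (8 : k) ≠ 0 := by simpa [show (8 : k) = 2 ^ 3 by norm_num] using h2
    field_simp
    norm_num
  have e2 : (256 : A) * algebraMap k A (27 / 16 ^ 2) = 27 := by
    rw [← map_ofNat (algebraMap k A) 256, ← map_mul, ← map_ofNat (algebraMap k A) 27]
    congr 1
    have : (16 : k) ≠ 0 := by simpa [show (16 : k) = 2 ^ 4 by norm_num] using h2
    field_simp
    norm_num
  rw [coverDiscriminant_eq]
  simp only [quarticP, map_add, map_sub, map_neg, map_mul, map_pow, aeval_X, aeval_C,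
    Matrix.cons_val]
  linear_combination (-(u * v * a ^ 2 * b ^ 2)) * e1 + (a ^ 4 * b ^ 4) * e2

lemma quarticP_isHomogeneous : (quarticP k).IsHomogeneous 4 := by
  unfold quarticP
  have hX := fun i : Fin 4 => isHomogeneous_X k i
  refine ((((IsHomogeneous.neg ?_).sub ?_).add ?_).add ?_).add ?_
  · exact ((hX 0).pow 2).mul ((hX 1).pow 2)
  · exact IsHomogeneous.C_mul ((((hX 0).mul (hX 1)).mul (hX 2)).mul (hX 3)) _
  · exact (hX 3).mul ((hX 1).pow 3)
  · exact (hX 2).mul ((hX 0).pow 3)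
  · exact IsHomogeneous.C_mul (((hX 2).pow 2).mul ((hX 3).pow 2)) _

/-! ### Irreducibility of the quartic -/

section Irreducible

open Polynomial in
/-- A primitive quadratic polynomial whose discriminant is not a square is irreducible. -/
lemma irreducible_quadratic {R : Type*} [CommRing R] [IsDomain R] {a b c : R} (ha : a ≠ 0)
    (hprim : ∀ d, d ∣ a → d ∣ b → d ∣ c → IsUnit d)
    (hdisc : ∀ r, b ^ 2 - 4 * a * c ≠ r ^ 2) :
    Irreducible (Polynomial.C a * Polynomial.X ^ 2 + Polynomial.C b * Polynomial.X +
      Polynomial.C c) := by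
  have hdeg := natDegree_quadratic (b := b) (c := c) ha
  set p := Polynomial.C a * Polynomial.X ^ 2 + Polynomial.C b * Polynomial.X + Polynomial.C c
    with hp
  have hp0 : p ≠ 0 := by
    intro h
    simp [h] at hdeg
  have hc2 : ∀ a b c : R, (Polynomial.C a * Polynomial.X ^ 2 + Polynomial.C b * Polynomial.X +
      Polynomial.C c).coeff 2 = a := by simp [Polynomial.coeff_X, Polynomial.coeff_C]
  have hc1 : ∀ a b c : R, (Polynomial.C a * Polynomial.X ^ 2 + Polynomial.C b * Polynomial.X +
      Polynomial.C c).coeff 1 = b := by simp [Polynomial.coeff_X, Polynomial.coeff_C]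
  have hc0 : ∀ a b c : R, (Polynomial.C a * Polynomial.X ^ 2 + Polynomial.C b * Polynomial.X +
      Polynomial.C c).coeff 0 = c := by simp
  have h2 : p.coeff 2 = a := hc2 a b c
  have h1 : p.coeff 1 = b := hc1 a b c
  have h0 : p.coeff 0 = c := hc0 a b c
  have const : ∀ (d : R) (g : R[X]), p = Polynomial.C d * g → IsUnit (Polynomial.C d) := by
    intro d g h
    refine Polynomial.isUnit_C.2 (hprim d ?_ ?_ ?_)
    · rw [← h2, h, Polynomial.coeff_C_mul]; exact dvd_mul_right _ _
    · rw [← h1, h, Polynomial.coeff_C_mul]; exact dvd_mul_right _ _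
    · rw [← h0, h, Polynomial.coeff_C_mul]; exact dvd_mul_right _ _
  refine ⟨fun h => by simp [natDegree_eq_zero_of_isUnit h] at hdeg, fun f g hfg => ?_⟩
  have hf : f ≠ 0 := by rintro rfl; exact hp0 (by simpa using hfg)
  have hg : g ≠ 0 := by rintro rfl; exact hp0 (by simpa using hfg)
  have hsum : f.natDegree + g.natDegree = 2 := by rw [← natDegree_mul hf hg, ← hfg, hdeg]
  have hcases : f.natDegree = 0 ∨ g.natDegree = 0 ∨ (f.natDegree = 1 ∧ g.natDegree = 1) := by omega
  rcases hcases with h | h | ⟨hf1, hg1⟩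
  · left
    rw [eq_C_of_natDegree_eq_zero h] at hfg ⊢
    exact const _ _ hfg
  · right
    rw [eq_C_of_natDegree_eq_zero h, mul_comm] at hfg
    rw [eq_C_of_natDegree_eq_zero h]
    exact const _ _ hfg
  · exfalso
    obtain ⟨a1, b1, rfl⟩ := exists_eq_X_add_C_of_natDegree_le_one hf1.le
    obtain ⟨a2, b2, rfl⟩ := exists_eq_X_add_C_of_natDegree_le_one hg1.le
    have e : p = Polynomial.C (a1 * a2) * Polynomial.X ^ 2 +
        Polynomial.C (a1 * b2 + a2 * b1) * Polynomial.X + Polynomial.C (b1 * b2) := by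
      rw [hfg]; simp only [Polynomial.C_mul, Polynomial.C_add]; ring
    have e2 : a = a1 * a2 := by rw [← h2, e, hc2]
    have e1 : b = a1 * b2 + a2 * b1 := by rw [← h1, e, hc1]
    have e0 : c = b1 * b2 := by rw [← h0, e, hc0]
    -- The discriminant of a product of two linear polynomials is the square of their resultant.
    exact hdisc (a1 * b2 - a2 * b1) (by rw [e2, e1, e0]; ring)

/-- As a quadratic in `β`, the form has leading coefficient a unit times `α²`, and `α` does not
divide the coefficient of `β`; so it is primitive, and only its discriminant remains to be examined.
-/
lemma quarticP_irreducible (h2 : (2 : k) ≠ 0) (h3 : (3 : k) ≠ 0) : Irreducible (quarticP k) := by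
  have h8 : (8 : k) ≠ 0 := by simpa [show (8 : k) = 2 ^ 3 by norm_num] using h2
  have h16 : (16 : k) ≠ 0 := by simpa [show (16 : k) = 2 ^ 4 by norm_num] using h2
  have h4 : (4 : k) ≠ 0 := by simpa [show (4 : k) = 2 ^ 2 by norm_num] using h2
  have h27 : (27 : k) ≠ 0 := by simpa [show (27 : k) = 3 ^ 3 by norm_num] using h3
  -- The swap makes `β` the polynomial variable; `v`, `α`, `u` become `X 0`, `X 1`, `X 2`.
  let e : MvPolynomial (Fin 4) k ≃ₐ[k] Polynomial (MvPolynomial (Fin 3) k) :=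
    (renameEquiv k (Equiv.swap (0 : Fin 4) 3)).trans (finSuccEquiv k 3)
  have hX3 : e (X 3) = Polynomial.X := by
    simp [e, finSuccEquiv_X_zero]
  have hX0 : e (X 0) = Polynomial.C (X 2) := by
    simpa [e] using finSuccEquiv_X_succ (R := k) (n := 3) (j := 2)
  have hX1 : e (X 1) = Polynomial.C (X 0) := by
    simpa [e, Equiv.swap_apply_of_ne_of_ne] using finSuccEquiv_X_succ (R := k) (n := 3) (j := 0)
  have hX2 : e (X 2) = Polynomial.C (X 1) := by
    simpa [e, Equiv.swap_apply_of_ne_of_ne] using finSuccEquiv_X_succ (R := k) (n := 3) (j := 1)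
  have hC : ∀ c, e (C c) = Polynomial.C (C c) := fun c => e.commutes c
  have key : e (quarticP k) =
      Polynomial.C (C (27 / 16 ^ 2) * X 1 ^ 2) * Polynomial.X ^ 2 +
      Polynomial.C (X 0 ^ 3 - C (9 / 8) * (X 2 * X 0 * X 1)) * Polynomial.X +
      Polynomial.C (X 1 * X 2 ^ 3 - X 2 ^ 2 * X 0 ^ 2) := by
    simp only [quarticP, map_add, map_sub, map_neg, map_mul, map_pow, hX0, hX1, hX2, hX3, hC]
    ring
  rw [← MulEquiv.irreducible_iff e.toMulEquiv]
  change Irreducible (e (quarticP k))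
  rw [key]
  apply irreducible_quadratic
  · exact mul_ne_zero (by simpa using ⟨h27, h16⟩) (pow_ne_zero _ (X_ne_zero _))
  · intro d hd1 hd2 _
    have hu : IsUnit (C (27 / 16 ^ 2) : MvPolynomial (Fin 3) k) :=
      (IsUnit.mk0 _ (div_ne_zero h27 (pow_ne_zero _ h16))).map C
    rw [hu.dvd_mul_left] at hd1
    obtain ⟨i, -, hi⟩ := (dvd_prime_pow (X_prime (R := k) (i := (1 : Fin 3))) 2).1 hd1
    rcases Nat.eq_zero_or_pos i with rfl | hpos
    · exact (associated_one_iff_isUnit).1 (by simpa using hi)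
    · exfalso
      have hX : (X 1 : MvPolynomial (Fin 3) k) ∣ X 0 ^ 3 - C (9 / 8) * (X 2 * X 0 * X 1) :=
        (dvd_pow_self _ hpos.ne').trans (hi.symm.dvd.trans hd2)
      obtain ⟨q, hq⟩ := hX
      simpa using congrArg (eval ![1, 0, 0]) hq
  · intro r hr
    -- At `v = 0`, `α = 1`, `u = T` the discriminant is a nonzero multiple of `T³`, of odd degree,
    -- hence not a square.
    have := congrArg (aeval ![(0 : Polynomial k), 1, Polynomial.X]) hr
    simp only [map_sub, map_mul, map_pow, aeval_X, aeval_C, Matrix.cons_val, map_ofNat] at this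
    have h' : Polynomial.C (-(4 * (27 / 16 ^ 2)) : k) * Polynomial.X ^ 3 =
        (aeval ![(0 : Polynomial k), 1, Polynomial.X] r) ^ 2 := by
      rw [← this]
      simp only [Polynomial.algebraMap_eq, Polynomial.C_neg, Polynomial.C_mul,
        show (Polynomial.C (4 : k)) = 4 from map_ofNat Polynomial.C 4]
      ring
    have hdeg := congrArg Polynomial.natDegree h'
    rw [Polynomial.natDegree_C_mul_X_pow _ _ (neg_ne_zero.2
      (mul_ne_zero h4 (div_ne_zero h27 (pow_ne_zero _ h16)))), Polynomial.natDegree_pow] at hdeg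
    omega

end Irreducible

/-! ### Chain rule and homogeneity for polynomials -/

section Calculus

variable {σ : Type*}

/-- The chain rule for derivations. -/
lemma derivation_aeval [Fintype σ] {A : Type*} [CommRing A] [Algebra k A] (D : Derivation k A A) (γ : σ → A)
    (F : MvPolynomial σ k) :
    D (aeval γ F) = ∑ i, aeval γ (pderiv i F) * D (γ i) := by
  classical
  induction F using MvPolynomial.induction_on with
  | C c => simp
  | add p q hp hq => simp [hp, hq, add_mul, Finset.sum_add_distrib]
  | mul_X p j hp =>
    simp only [map_mul, aeval_X, Derivation.leibniz, hp, smul_eq_mul, map_add, pderiv_X, add_mul,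
      Finset.sum_add_distrib, Finset.mul_sum]
    congr 1
    · rw [Finset.sum_eq_single j]
      · simp
      · intro b _ hb
        simp [hb.symm]
      · simp
    · exact Finset.sum_congr rfl fun i _ => by ring

lemma derivative_aeval [Fintype σ] (γ : σ → Polynomial k) (F : MvPolynomial σ k) :
    Polynomial.derivative (aeval γ F) =
      ∑ i, aeval γ (pderiv i F) * Polynomial.derivative (γ i) :=
  derivation_aeval Polynomial.derivative' γ F

lemma eval_aeval (x : k) (γ : σ → Polynomial k) (F : MvPolynomial σ k) :
    (aeval γ F).eval x = eval (fun i => (γ i).eval x) F := by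
  induction F using MvPolynomial.induction_on with
  | C c => simp
  | add p q hp hq => simp [hp, hq]
  | mul_X p j hp => simp [hp]

lemma _root_.MvPolynomial.IsHomogeneous.eval_smul {F : MvPolynomial σ k} {d : ℕ}
    (hF : F.IsHomogeneous d) (a : k) (x : σ → k) : eval (a • x) F = a ^ d * eval x F := by
  rw [eval_eq, eval_eq, Finset.mul_sum]
  refine Finset.sum_congr rfl fun m hm => ?_
  have := hF (mem_support_iff.1 hm)
  rw [← this]
  simp only [Pi.smul_apply, smul_eq_mul, mul_pow, Finset.prod_mul_distrib,
    Finset.prod_pow_eq_pow_sum, Finsupp.weight_apply, Finsupp.sum, Pi.one_apply, mul_one]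
  ring

end Calculus

/-! ### Double roots of binary cubics -/

section BinaryCubics

/-- A binary cubic form with vanishing discriminant has a common zero of its partial
derivatives. -/
lemma exists_double_root (h2 : (2 : k) ≠ 0) (h3 : (3 : k) ≠ 0) {P : Cubic k} (hP : P.discr = 0) :
    ∃ S T : k, (S ≠ 0 ∨ T ≠ 0) ∧ 3 * P.a * S ^ 2 + 2 * P.b * S * T + P.c * T ^ 2 = 0 ∧
      P.b * S ^ 2 + 2 * P.c * S * T + 3 * P.d * T ^ 2 = 0 := by
  obtain ⟨a, b, c, d⟩ := P
  simp only [Cubic.discr] at hP ⊢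
  -- The Hessian `(b²-3ac) s² + (bc-9ad) st + (c²-3bd) t²` has discriminant `-3` times that of the
  -- cubic. So it is zero or has a double root, and in the latter case that root is the one sought.
  have hQ : (b * c - 9 * a * d) ^ 2 = 4 * (b ^ 2 - 3 * a * c) * (c ^ 2 - 3 * b * d) := by
    linear_combination (-3) * hP
  by_cases h0 : b ^ 2 - 3 * a * c = 0
  · have h1 : b * c - 9 * a * d = 0 := by
      rw [h0] at hQ
      simpa using hQ
    by_cases hc : c ^ 2 - 3 * b * d = 0
    · by_cases ha : a = 0
      · subst ha
        have hb : b = 0 := by simpa using h0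
        subst hb
        exact ⟨1, 0, by simp, by simp, by simp⟩
      · refine ⟨b, -3 * a, Or.inr (mul_ne_zero (neg_ne_zero.2 h3) ha), ?_, ?_⟩
        · linear_combination (-3 * a) * h0
        · linear_combination b * h0 - 3 * a * h1
    · have ha : 3 * a = 0 := by
        have : 3 * a * (c ^ 2 - 3 * b * d) = 0 := by linear_combination b * h1 - c * h0
        exact (mul_eq_zero.1 this).resolve_right hc
      have hb : b = 0 := by
        have : b * (c ^ 2 - 3 * b * d) = 0 := by linear_combination c * h1 - 3 * d * h0
        exact (mul_eq_zero.1 this).resolve_right hc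
      exact ⟨1, 0, by simp, by simp [ha], by simp [hb]⟩
  · refine ⟨b * c - 9 * a * d, -2 * (b ^ 2 - 3 * a * c),
      Or.inr (mul_ne_zero (neg_ne_zero.2 h2) h0), ?_, ?_⟩
    · linear_combination (3 * a) * hQ
    · linear_combination b * hQ

/-- A binary cubic form whose partial derivatives vanish at `(S, T)` is divisible by the square of
`T s - S t`. -/
lemma exists_factor_of_double_root (h3 : (3 : k) ≠ 0) {P : Cubic k} {S T : k} (h : S ≠ 0 ∨ T ≠ 0)
    (h1 : 3 * P.a * S ^ 2 + 2 * P.b * S * T + P.c * T ^ 2 = 0)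
    (h2 : P.b * S ^ 2 + 2 * P.c * S * T + 3 * P.d * T ^ 2 = 0) :
    ∃ m n : k, P = ⟨T ^ 2 * m, T ^ 2 * n - 2 * S * T * m, S ^ 2 * m - 2 * S * T * n, S ^ 2 * n⟩ := by
  obtain ⟨a, b, c, d⟩ := P
  simp only [Cubic.mk.injEq] at *
  by_cases hT : T = 0
  · have hS : S ≠ 0 := by tauto
    subst hT
    have ha : a = 0 := by simpa [h3, hS] using h1
    have hb : b = 0 := by simpa [hS] using h2
    exact ⟨c / S ^ 2, d / S ^ 2, by simp [ha], by simp [hb], by field_simp; simp, by field_simp⟩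
  -- The cofactor `m s + n t` is read off from the coefficients of `s³` and `s²t`.
  · refine ⟨a / T ^ 2, (b + 2 * S * a / T) / T ^ 2, ?_, ?_, ?_, ?_⟩
    · field_simp
    · field_simp; ring
    · field_simp
      linear_combination h1
    · field_simp
      apply mul_left_cancel₀ h3
      linear_combination T * h2 - 2 * S * h1

lemma discr_of_factor (S T m n : k) :
    (⟨T ^ 2 * m, T ^ 2 * n - 2 * S * T * m, S ^ 2 * m - 2 * S * T * n, S ^ 2 * n⟩ : Cubic k).discr
      = 0 := by
  simp only [Cubic.discr]; ring

lemma discr_eq_zero_iff_exists_double_root (h2 : (2 : k) ≠ 0) (h3 : (3 : k) ≠ 0) (P : Cubic k) :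
    P.discr = 0 ↔
    ∃ S T : k, (S ≠ 0 ∨ T ≠ 0) ∧ 3 * P.a * S ^ 2 + 2 * P.b * S * T + P.c * T ^ 2 = 0 ∧
      P.b * S ^ 2 + 2 * P.c * S * T + 3 * P.d * T ^ 2 = 0 := by
  refine ⟨exists_double_root h2 h3, ?_⟩
  rintro ⟨S, T, h, h', h''⟩
  obtain ⟨m, n, rfl⟩ := exists_factor_of_double_root h3 h h' h''
  exact discr_of_factor S T m n

end BinaryCubics

/-! ### The twisted cubic, its quadrics and its tangent lines -/

section TwistedCubic

/-- The affine parametrization of the twisted cubic. -/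
def cubicPt {A : Type*} [CommRing A] (s t : A) : Fin 4 → A := ![s ^ 3, s ^ 2 * t, s * t ^ 2, t ^ 3]

/-- The derivative of the parametrization of the twisted cubic in the first variable. -/
def cubicDs {A : Type*} [CommRing A] (s t : A) : Fin 4 → A := ![3 * s ^ 2, 2 * s * t, t ^ 2, 0]

/-- The derivative of the parametrization of the twisted cubic in the second variable. -/
def cubicDt {A : Type*} [CommRing A] (s t : A) : Fin 4 → A := ![0, s ^ 2, 2 * s * t, 3 * t ^ 2]

/-- The three quadrics through the twisted cubic. -/
def quad {A : Type*} [CommRing A] (x : Fin 4 → A) : Fin 3 → A :=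
  ![x 0 * x 2 - x 1 ^ 2, x 0 * x 3 - x 1 * x 2, x 1 * x 3 - x 2 ^ 2]

/-- The quartic form that defines the tangential developable of the twisted cubic. -/
def cubicDisc {A : Type*} [CommRing A] (x : Fin 4 → A) : A :=
  quad x 1 ^ 2 - 4 * quad x 0 * quad x 2

/-- The differentials at `p` of the three quadrics through the twisted cubic. -/
def polarQuad {A : Type*} [CommRing A] (p w : Fin 4 → A) : Fin 3 → A :=
  ![p 0 * w 2 + p 2 * w 0 - 2 * p 1 * w 1, p 0 * w 3 + p 3 * w 0 - p 1 * w 2 - p 2 * w 1,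
    p 1 * w 3 + p 3 * w 1 - 2 * p 2 * w 2]

lemma quad_cubicPt (s t : k) (i : Fin 3) : quad (cubicPt s t) i = 0 := by
  fin_cases i <;> simp [quad, cubicPt] <;> ring

lemma cubicPt_eq_zero_iff {s t : k} : cubicPt s t = 0 ↔ s = 0 ∧ t = 0 := by
  constructor
  · intro h
    have h0 := congrFun h 0
    have h3 := congrFun h 3
    simp [cubicPt] at h0 h3
    exact ⟨h0, h3⟩
  · rintro ⟨rfl, rfl⟩
    ext i
    fin_cases i <;> simp [cubicPt]

lemma cubicPt_ne_zero {s t : k} (h : s ≠ 0 ∨ t ≠ 0) : cubicPt s t ≠ 0 := by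
  rw [Ne, cubicPt_eq_zero_iff]
  tauto

lemma smul_cubicPt (r s t : k) : r ^ 3 • cubicPt s t = cubicPt (r * s) (r * t) := by
  ext i
  fin_cases i <;> simp [cubicPt] <;> ring

lemma cubicPt_eq_tangent (s t : k) : s • cubicDs s t + t • cubicDt s t = (3 : k) • cubicPt s t := by
  ext i
  fin_cases i <;> simp [cubicPt, cubicDs, cubicDt] <;> ring

/-- The quadrics determine the ratios of the coordinates; a cube root of `x₀`, or of `x₃` if `x₀ =
0`, gives equality of vectors and not only of points. -/
lemma exists_eq_cubicPt [IsAlgClosed k] {x : Fin 4 → k} (h : ∀ i, quad x i = 0) :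
    ∃ s t : k, x = cubicPt s t := by
  have e0 : x 0 * x 2 - x 1 ^ 2 = 0 := by simpa [quad] using h 0
  have e1 : x 0 * x 3 - x 1 * x 2 = 0 := by simpa [quad] using h 1
  have e2 : x 1 * x 3 - x 2 ^ 2 = 0 := by simpa [quad] using h 2
  by_cases h0 : x 0 = 0
  · have h1 : x 1 = 0 := by simpa [h0] using e0
    have h2 : x 2 = 0 := by simpa [h1] using e2
    obtain ⟨t, ht⟩ := IsAlgClosed.exists_pow_nat_eq (x 3) (n := 3) (by norm_num)
    refine ⟨0, t, ?_⟩
    ext i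
    fin_cases i <;> simp [cubicPt, h0, h1, h2, ht]
  · obtain ⟨s, hs⟩ := IsAlgClosed.exists_pow_nat_eq (x 0) (n := 3) (by norm_num)
    have hs0 : s ≠ 0 := by
      rintro rfl
      exact h0 (by simpa using hs.symm)
    have h2 : x 2 = x 1 ^ 2 / x 0 := by
      field_simp
      linear_combination e0
    have h3 : x 3 = x 1 ^ 3 / x 0 ^ 2 := by
      field_simp
      linear_combination x 0 * e1 + x 1 * e0
    refine ⟨s, x 1 / s ^ 2, ?_⟩
    ext i
    fin_cases i
    · simp [cubicPt, hs]
    · simp [cubicPt]; field_simp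
    · simp [cubicPt, h2, ← hs]; field_simp
    · simp [cubicPt, h3, ← hs]; field_simp

lemma cubicDisc_eq (x : Fin 4 → k) :
    (⟨x 0, 3 * x 1, 3 * x 2, x 3⟩ : Cubic k).discr = -27 * cubicDisc x := by
  simp [Cubic.discr, cubicDisc, quad]; ring

/-- In binomial coordinates `cubicPt s t` is the cube of the linear form with coefficients `s`, `t`,
and the tangent vectors there are the multiples of its square. So a cubic on a tangent line is one
with a double root. -/
lemma cubicDisc_eq_zero_iff (h2 : (2 : k) ≠ 0) (h3 : (3 : k) ≠ 0) (x : Fin 4 → k) :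
    cubicDisc x = 0 ↔
      ∃ s t : k, (s ≠ 0 ∨ t ≠ 0) ∧ ∃ p q : k, x = p • cubicDs s t + q • cubicDt s t := by
  constructor
  · intro h
    obtain ⟨S, T, hST, e1, e2⟩ := exists_double_root h2 h3
      (P := ⟨x 0, 3 * x 1, 3 * x 2, x 3⟩) (by rw [cubicDisc_eq, h, mul_zero])
    obtain ⟨m, n, hmn⟩ := exists_factor_of_double_root h3 hST e1 e2
    simp only [Cubic.mk.injEq] at hmn
    obtain ⟨e0, e1, e2, e3⟩ := hmn
    -- The double factor is `T s - S t`, whence the parameter `(T : -S)`; the division by 3 comes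
    -- from differentiating a cube.
    refine ⟨T, -S, by simpa [or_comm] using hST, m / 3, n / 3, ?_⟩
    ext i
    fin_cases i <;> simp [cubicDs, cubicDt] <;> field_simp
    · linear_combination e0
    · linear_combination e1
    · linear_combination e2
    · linear_combination e3
  · rintro ⟨s, t, -, p, q, rfl⟩
    simp [cubicDisc, quad, cubicDs, cubicDt]
    ring

/-- The three quadrics have independent enough differentials to cut out the curve without excess
tangent directions; this bounds the embedded tangent space from above. -/
lemma polarQuad_eq_zero_iff (h3 : (3 : k) ≠ 0) {s t : k} (h : s ≠ 0 ∨ t ≠ 0) (w : Fin 4 → k) :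
    (∀ i, polarQuad (cubicPt s t) w i = 0) ↔ ∃ p q : k, w = p • cubicDs s t + q • cubicDt s t := by
  constructor
  · intro H
    have e0 := H 0
    have e1 := H 1
    have e2 := H 2
    simp [polarQuad, cubicPt] at e0 e1 e2
    by_cases hs : s = 0
    · have ht : t ≠ 0 := by tauto
      subst hs
      have hw0 : w 0 = 0 := by simpa [ht] using e1
      have hw1 : w 1 = 0 := by simpa [ht] using e2
      refine ⟨w 2 / t ^ 2, w 3 / (3 * t ^ 2), ?_⟩
      ext i
      fin_cases i <;> simp [cubicDs, cubicDt, hw0, hw1] <;> field_simp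
    · refine ⟨w 0 / (3 * s ^ 2), (w 1 - 2 * t * w 0 / (3 * s)) / s ^ 2, ?_⟩
      ext i
      fin_cases i <;> simp [cubicDs, cubicDt] <;> field_simp
      · ring
      · apply mul_left_cancel₀ hs
        linear_combination 3 * e0
      · apply mul_left_cancel₀ hs
        linear_combination e1 * s + t * e0
  · rintro ⟨p, q, rfl⟩ i
    fin_cases i <;> simp [polarQuad, cubicPt, cubicDs, cubicDt] <;> ring

end TwistedCubic

/-! ### Linear changes of coordinates and directional derivatives -/

section LinearChange

/-- The form `F ∘ g` obtained from a form by a linear change of coordinates. -/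
def compLinear (F : MvPolynomial (Fin 4) k) (g : (Fin 4 → k) ≃ₗ[k] (Fin 4 → k)) :
    MvPolynomial (Fin 4) k :=
  aeval (fun i => ∑ j, C (g (Pi.single j 1) i) * X j) F

lemma linearEquiv_apply_eq_sum (g : (Fin 4 → k) ≃ₗ[k] (Fin 4 → k)) (x : Fin 4 → k) (i : Fin 4) :
    g x i = ∑ j, g (Pi.single j 1) i * x j := by
  conv_lhs => rw [pi_eq_sum_univ' x]
  simp [map_sum, mul_comm]

lemma aeval_compLinear {A : Type*} [CommRing A] [Algebra k A] (F : MvPolynomial (Fin 4) k)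
    (g : (Fin 4 → k) ≃ₗ[k] (Fin 4 → k)) (γ : Fin 4 → A) :
    aeval γ (compLinear F g) =
      aeval (fun i => ∑ j, algebraMap k A (g (Pi.single j 1) i) * γ j) F := by
  rw [compLinear, ← AlgHom.comp_apply]
  congr 1
  ext i
  simp

lemma eval_compLinear (F : MvPolynomial (Fin 4) k) (g : (Fin 4 → k) ≃ₗ[k] (Fin 4 → k))
    (x : Fin 4 → k) : eval x (compLinear F g) = eval (g x) F := by
  have := aeval_compLinear F g x
  simp only [Algebra.algebraMap_self, RingHom.id_apply, ← linearEquiv_apply_eq_sum] at this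
  exact this

lemma compLinear_isHomogeneous {F : MvPolynomial (Fin 4) k} {d : ℕ} (hF : F.IsHomogeneous d)
    (g : (Fin 4 → k) ≃ₗ[k] (Fin 4 → k)) : (compLinear F g).IsHomogeneous d := by
  have := hF.aeval (fun i => ∑ j, C (g (Pi.single j 1) i) * X j) (n := 1) fun i =>
    IsHomogeneous.sum _ _ _ fun j _ => isHomogeneous_C_mul_X _ _
  rwa [one_mul] at this

/-- The derivative of `F` at `p` in the direction `w`. -/
def dirDeriv (F : MvPolynomial (Fin 4) k) (p w : Fin 4 → k) : k :=
  ∑ i, w i * eval p (pderiv i F)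

lemma dirDeriv_add (F : MvPolynomial (Fin 4) k) (p v w : Fin 4 → k) :
    dirDeriv F p (v + w) = dirDeriv F p v + dirDeriv F p w := by
  simp [dirDeriv, add_mul, Finset.sum_add_distrib]

lemma dirDeriv_smul (F : MvPolynomial (Fin 4) k) (p : Fin 4 → k) (a : k) (w : Fin 4 → k) :
    dirDeriv F p (a • w) = a * dirDeriv F p w := by
  simp [dirDeriv, Finset.mul_sum, mul_assoc]

lemma dirDeriv_compLinear (F : MvPolynomial (Fin 4) k) (g : (Fin 4 → k) ≃ₗ[k] (Fin 4 → k))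
    (p w : Fin 4 → k) : dirDeriv (compLinear F g) p w = dirDeriv F (g p) (g w) := by
  have h : ∀ j, pderiv j (compLinear F g) =
      ∑ i, compLinear (pderiv i F) g * C (g (Pi.single j 1) i) := by
    intro j
    rw [compLinear, derivation_aeval]
    refine Finset.sum_congr rfl fun i _ => ?_
    simp [compLinear, pderiv_X, Pi.single_apply]
  simp only [dirDeriv, h, map_sum, map_mul, eval_C, eval_compLinear, Finset.mul_sum]
  rw [Finset.sum_comm]
  refine Finset.sum_congr rfl fun i _ => ?_
  rw [linearEquiv_apply_eq_sum g w, Finset.sum_mul]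
  exact Finset.sum_congr rfl fun j _ => by ring

/-- A polynomial that vanishes along a polynomial curve has zero derivative along its tangent. -/
lemma dirDeriv_eq_zero_of_curve [Infinite k] {F : MvPolynomial (Fin 4) k}
    (γ : Fin 4 → Polynomial k) (h : ∀ x, eval (fun i => (γ i).eval x) F = 0) (x : k) :
    dirDeriv F (fun i => (γ i).eval x) (fun i => (Polynomial.derivative (γ i)).eval x) = 0 := by
  have h0 : aeval γ F = 0 := Polynomial.funext fun y => by rw [eval_aeval, h, Polynomial.eval_zero]
  have := congrArg (Polynomial.eval x) (derivative_aeval γ F)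
  rw [h0] at this
  simp only [Polynomial.derivative_zero, Polynomial.eval_zero, Polynomial.eval_finsetSum,
    Polynomial.eval_mul, eval_aeval] at this
  rw [dirDeriv, this]
  exact Finset.sum_congr rfl fun i _ => mul_comm _ _

lemma dirDeriv_cubicDs_eq_zero [Infinite k] {F : MvPolynomial (Fin 4) k}
    (h : ∀ s t, eval (cubicPt s t) F = 0) (s t : k) :
    dirDeriv F (cubicPt s t) (cubicDs s t) = 0 := by
  have a1 : ∀ x, (fun i => (cubicPt Polynomial.X (Polynomial.C t) i).eval x) = cubicPt x t := by
    intro x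
    ext i
    fin_cases i <;> simp [cubicPt] <;> ring
  have a2 : (fun i => (Polynomial.derivative (cubicPt Polynomial.X (Polynomial.C t) i)).eval s) =
      cubicDs s t := by
    ext i
    fin_cases i <;> simp [cubicPt, cubicDs, -mul_eq_mul_left_iff, -mul_eq_mul_right_iff,
      Polynomial.derivative_pow]
    ring
  have := dirDeriv_eq_zero_of_curve (F := F) (cubicPt Polynomial.X (Polynomial.C t))
    (fun x => by rw [a1]; exact h x t) s
  rwa [a1, a2] at this

lemma dirDeriv_cubicDt_eq_zero [Infinite k] {F : MvPolynomial (Fin 4) k}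
    (h : ∀ s t, eval (cubicPt s t) F = 0) (s t : k) :
    dirDeriv F (cubicPt s t) (cubicDt s t) = 0 := by
  have a1 : ∀ x, (fun i => (cubicPt (Polynomial.C s) Polynomial.X i).eval x) = cubicPt s x := by
    intro x
    ext i
    fin_cases i <;> simp [cubicPt]
  have a2 : (fun i => (Polynomial.derivative (cubicPt (Polynomial.C s) Polynomial.X i)).eval t) =
      cubicDt s t := by
    ext i
    fin_cases i <;> simp [cubicPt, cubicDt, -mul_eq_mul_left_iff, -mul_eq_mul_right_iff,
      Polynomial.derivative_pow]
    ring
  have := dirDeriv_eq_zero_of_curve (F := F) (cubicPt (Polynomial.C s) Polynomial.X)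
    (fun x => by rw [a1]; exact h s x) t
  rwa [a1, a2] at this

end LinearChange

/-! ### Tangent spaces, developable and dual surface of a twisted cubic -/

section Points

lemma exists_mem_image_standardTwistedCubic (g : (Fin 4 → k) ≃ₗ[k] (Fin 4 → k)) {s t : k}
    (h : s ≠ 0 ∨ t ≠ 0) :
    ∃ x ∈ Projectivization.map g.toLinearMap g.injective '' standardTwistedCubic k,
      ∃ a : k, a ≠ 0 ∧ x.rep = a • g (cubicPt s t) := by
  have h0 : g (cubicPt s t) ≠ 0 := by simpa using cubicPt_ne_zero h
  obtain ⟨a, ha⟩ := Projectivization.exists_smul_eq_mk_rep k (g (cubicPt s t)) h0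
  refine ⟨Projectivization.mk k (g (cubicPt s t)) h0, ⟨_, ⟨s, t, cubicPt_ne_zero h, rfl⟩, ?_⟩, a,
    a.ne_zero, ha.symm⟩
  exact Projectivization.map_mk g.toLinearMap g.injective (cubicPt s t) (cubicPt_ne_zero h)

lemma eval_eq_zero_of_vanishes {g : (Fin 4 → k) ≃ₗ[k] (Fin 4 → k)}
    {f : MvPolynomial (Fin 4) k} {d : ℕ} (hf : f.IsHomogeneous d)
    (h : ∀ z ∈ Projectivization.map g.toLinearMap g.injective '' standardTwistedCubic k,
      eval z.rep f = 0) (s t : k) : eval (g (cubicPt s t)) f = 0 := by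
  have hne : ∀ s t : k, (s ≠ 0 ∨ t ≠ 0) → eval (g (cubicPt s t)) f = 0 := by
    intro s t hst
    obtain ⟨x, hx, a, ha, e⟩ := exists_mem_image_standardTwistedCubic g hst
    have := h x hx
    rw [e, hf.eval_smul] at this
    exact (mul_eq_zero.1 this).resolve_left (pow_ne_zero _ ha)
  by_cases hst : s ≠ 0 ∨ t ≠ 0
  · exact hne s t hst
  -- The origin is written as `0` times a point of the cone, since a form of degree `0` need not
  -- vanish there.
  · have h0 : cubicPt s t = (0 : k) • cubicPt 1 0 := by
      rw [zero_smul, cubicPt_eq_zero_iff]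
      simpa [not_or] using hst
    rw [h0, map_smul, hf.eval_smul, hne 1 0 (by simp), mul_zero]

variable [IsAlgClosed k]

/-- The scalar between the chosen representative and a parametrized point has a cube root, which is
absorbed into `(s, t)`. -/
lemma mem_image_standardTwistedCubic (g : (Fin 4 → k) ≃ₗ[k] (Fin 4 → k))
    (x : ℙ k (Fin 4 → k)) :
    x ∈ Projectivization.map g.toLinearMap g.injective '' standardTwistedCubic k ↔
      ∃ s t : k, (s ≠ 0 ∨ t ≠ 0) ∧ x.rep = g (cubicPt s t) := by
  constructor
  · rintro ⟨_, ⟨s, t, h, rfl⟩, rfl⟩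
    have hst : s ≠ 0 ∨ t ≠ 0 := by
      by_contra! H
      exact h (cubicPt_eq_zero_iff.2 H)
    rw [Projectivization.map_mk]
    obtain ⟨a, ha⟩ := Projectivization.exists_smul_eq_mk_rep k (g.toLinearMap (cubicPt s t))
      (by simpa using cubicPt_ne_zero hst)
    obtain ⟨r, hr⟩ := IsAlgClosed.exists_pow_nat_eq (a : k) (n := 3) (by norm_num)
    have hr0 : r ≠ 0 := by
      rintro rfl
      exact a.ne_zero (by simpa using hr.symm)
    refine ⟨r * s, r * t, by simpa [hr0] using hst, ?_⟩
    rw [← smul_cubicPt, hr, map_smul]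
    exact ha.symm
  · rintro ⟨s, t, hst, hx⟩
    refine ⟨Projectivization.mk k (cubicPt s t) (cubicPt_ne_zero hst), ⟨s, t, _, rfl⟩, ?_⟩
    rw [Projectivization.map_mk, ← x.mk_rep]
    congr 1
    exact hx.symm

lemma exists_rep_eq_cubicPt (g : (Fin 4 → k) ≃ₗ[k] (Fin 4 → k)) {s t : k}
    (h : s ≠ 0 ∨ t ≠ 0) :
    ∃ x ∈ Projectivization.map g.toLinearMap g.injective '' standardTwistedCubic k,
      ∃ r : k, r ≠ 0 ∧ x.rep = g (cubicPt (r * s) (r * t)) := by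
  obtain ⟨y, hy, a, ha, e⟩ := exists_mem_image_standardTwistedCubic g h
  obtain ⟨r, hr⟩ := IsAlgClosed.exists_pow_nat_eq a (n := 3) (by norm_num)
  refine ⟨y, hy, r, ?_, by rw [e, ← smul_cubicPt, hr, map_smul]⟩
  rintro rfl
  exact ha (by simpa using hr.symm)

/-- The transported quadrics give one inclusion. The other is the chain rule along the
parametrization: any form vanishing on the curve has zero derivative in both parameter directions.
-/
lemma mem_embeddedTangentSpace_iff (h3 : (3 : k) ≠ 0) (g : (Fin 4 → k) ≃ₗ[k] (Fin 4 → k))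
    {y : ℙ k (Fin 4 → k)} {s t : k} (hst : s ≠ 0 ∨ t ≠ 0) (hy : y.rep = g (cubicPt s t))
    (w : Fin 4 → k) :
    w ∈ embeddedTangentSpace
        (Projectivization.map g.toLinearMap g.injective '' standardTwistedCubic k) y ↔
      ∃ p q : k, w = g (p • cubicDs s t + q • cubicDt s t) := by
  have : Infinite k := IsAlgClosed.instInfinite
  constructor
  · intro hw
    have key : ∀ i, polarQuad (cubicPt s t) (g.symm w) i = 0 := by
      intro i
      have hX := fun j : Fin 4 => isHomogeneous_X k j
      let f : MvPolynomial (Fin 4) k := quad X i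
      have hf : f.IsHomogeneous 2 := by
        fin_cases i
        · exact ((hX 0).mul (hX 2)).sub ((hX 1).pow 2)
        · exact ((hX 0).mul (hX 3)).sub ((hX 1).mul (hX 2))
        · exact ((hX 1).mul (hX 3)).sub ((hX 2).pow 2)
      have hfe : ∀ x, eval x f = quad x i := by
        intro x
        fin_cases i <;> simp [f, quad]
      have hfd : ∀ x v, dirDeriv f x v = polarQuad x v i := by
        intro x v
        fin_cases i <;> simp [f, quad, polarQuad, dirDeriv, Fin.sum_univ_four, pderiv_X,
          Pi.single_apply] <;> ring
      have := hw 2 (compLinear f g.symm) (compLinear_isHomogeneous hf _) ?_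
      · change dirDeriv _ _ _ = 0 at this
        rwa [dirDeriv_compLinear, hfd, hy, g.symm_apply_apply] at this
      · intro z hz
        obtain ⟨s', t', -, e⟩ := (mem_image_standardTwistedCubic g z).1 hz
        rw [eval_compLinear, e, g.symm_apply_apply, hfe, quad_cubicPt]
    obtain ⟨p, q, e⟩ := (polarQuad_eq_zero_iff h3 hst _).1 key
    exact ⟨p, q, by rw [← e, g.apply_symm_apply]⟩
  · rintro ⟨p, q, rfl⟩ d f hf hv
    change dirDeriv _ _ _ = 0
    rw [hy, ← dirDeriv_compLinear, dirDeriv_add, dirDeriv_smul, dirDeriv_smul]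
    have hz : ∀ s t, eval (cubicPt s t) (compLinear f g) = 0 := fun s t => by
      rw [eval_compLinear]
      exact eval_eq_zero_of_vanishes hf hv s t
    rw [dirDeriv_cubicDs_eq_zero hz, dirDeriv_cubicDt_eq_zero hz]
    ring

lemma mem_tangentialDevelopable_iff (h2 : (2 : k) ≠ 0) (h3 : (3 : k) ≠ 0)
    (g : (Fin 4 → k) ≃ₗ[k] (Fin 4 → k)) (x : ℙ k (Fin 4 → k)) :
    x ∈ tangentialDevelopable
        (Projectivization.map g.toLinearMap g.injective '' standardTwistedCubic k) ↔
      cubicDisc (g.symm x.rep) = 0 := by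
  rw [cubicDisc_eq_zero_iff h2 h3]
  constructor
  · rintro ⟨y, hy, hx⟩
    obtain ⟨s, t, hst, e⟩ := (mem_image_standardTwistedCubic g y).1 hy
    obtain ⟨p, q, h⟩ := (mem_embeddedTangentSpace_iff h3 g hst e _).1 hx
    exact ⟨s, t, hst, p, q, by rw [h, g.symm_apply_apply]⟩
  · rintro ⟨s, t, hst, p, q, h⟩
    obtain ⟨y, hy, r, hr0, e⟩ := exists_rep_eq_cubicPt g hst
    -- Tangent vectors are quadratic in the parameters, so scaling these by `r` divides the
    -- coefficients by `r²`.
    refine ⟨y, hy, (mem_embeddedTangentSpace_iff h3 g (s := r * s) (t := r * t)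
      (by simpa [hr0] using hst) e _).2
      ⟨p / r ^ 2, q / r ^ 2, ?_⟩⟩
    rw [← g.symm_apply_eq, h]
    ext i
    fin_cases i <;> simp [cubicDs, cubicDt] <;> field_simp

/-- The cubic `P` is the restriction of the plane `x` to the parametrized curve. Tangency at `(s :
t)` means that both partial derivatives of `P` vanish there. -/
lemma mem_dualSurface_iff (h2 : (2 : k) ≠ 0) (h3 : (3 : k) ≠ 0)
    (g : (Fin 4 → k) ≃ₗ[k] (Fin 4 → k)) (x : ℙ k (Fin 4 → k)) (P : Cubic k)
    (hP : ∀ v, x.rep ⬝ᵥ g v = ![P.a, P.b, P.c, P.d] ⬝ᵥ v) :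
    x ∈ dualSurface
        (Projectivization.map g.toLinearMap g.injective '' standardTwistedCubic k) ↔
      P.discr = 0 := by
  rw [discr_eq_zero_iff_exists_double_root h2 h3]
  have tangent : ∀ s t : k, (∀ p q : k, x.rep ⬝ᵥ g (p • cubicDs s t + q • cubicDt s t) = 0) ↔
      3 * P.a * s ^ 2 + 2 * P.b * s * t + P.c * t ^ 2 = 0 ∧
        P.b * s ^ 2 + 2 * P.c * s * t + 3 * P.d * t ^ 2 = 0 := by
    intro s t
    have e : ∀ p q : k, x.rep ⬝ᵥ g (p • cubicDs s t + q • cubicDt s t) =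
        p * (3 * P.a * s ^ 2 + 2 * P.b * s * t + P.c * t ^ 2) +
        q * (P.b * s ^ 2 + 2 * P.c * s * t + 3 * P.d * t ^ 2) := by
      intro p q
      rw [hP]
      simp [dotProduct, Fin.sum_univ_four, cubicDs, cubicDt]
      ring
    simp only [e]
    refine ⟨fun h => ⟨by simpa using h 1 0, by simpa using h 0 1⟩, fun h p q => ?_⟩
    rw [h.1, h.2]
    ring
  constructor
  · rintro ⟨y, hy, hx⟩
    obtain ⟨s, t, hst, e⟩ := (mem_image_standardTwistedCubic g y).1 hy
    exact ⟨s, t, hst, (tangent s t).1 fun p q =>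
      hx _ ((mem_embeddedTangentSpace_iff h3 g hst e _).2 ⟨p, q, rfl⟩)⟩
  · rintro ⟨s, t, hst, h⟩
    obtain ⟨y, hy, r, hr0, e⟩ := exists_rep_eq_cubicPt g hst
    refine ⟨y, hy, fun w hw => ?_⟩
    obtain ⟨p, q, rfl⟩ := (mem_embeddedTangentSpace_iff h3 g (s := r * s) (t := r * t)
      (by simpa [hr0] using hst) e _).1 hw
    refine (tangent (r * s) (r * t)).2 ⟨?_, ?_⟩ p q
    · linear_combination r ^ 2 * h.1
    · linear_combination r ^ 2 * h.2

end Points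

/-! ### The quartic as a discriminant: singular locus, dual surface, developable -/

section Coordinates

lemma four_ne_zero_of_two_ne_zero (h2 : (2 : k) ≠ 0) : (4 : k) ≠ 0 := by
  simpa [show (4 : k) = 2 ^ 2 by norm_num] using h2

lemma eight_ne_zero_of_two_ne_zero (h2 : (2 : k) ≠ 0) : (8 : k) ≠ 0 := by
  simpa [show (8 : k) = 2 ^ 3 by norm_num] using h2

lemma sixteen_ne_zero_of_two_ne_zero (h2 : (2 : k) ≠ 0) : (16 : k) ≠ 0 := by
  simpa [show (16 : k) = 2 ^ 4 by norm_num] using h2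

/-- The linear change of coordinates that carries the standard twisted cubic to the singular locus
of the quartic. -/
def singularCoords (h2 : (2 : k) ≠ 0) (h3 : (3 : k) ≠ 0) : (Fin 4 → k) ≃ₗ[k] (Fin 4 → k) where
  toFun x := ![3 * x 1, 3 * x 2, 4 * x 3, 4 * x 0]
  invFun y := ![y 3 / 4, y 0 / 3, y 1 / 3, y 2 / 4]
  map_add' x y := by
    ext i
    fin_cases i <;> simp <;> ring
  map_smul' c x := by
    ext i
    fin_cases i <;> simp <;> ring
  left_inv x := by
    have h4 := four_ne_zero_of_two_ne_zero h2
    ext i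
    fin_cases i <;> simp <;> field_simp
  right_inv y := by
    have h4 := four_ne_zero_of_two_ne_zero h2
    ext i
    fin_cases i <;> simp <;> field_simp

/-- The linear change of coordinates that carries the standard twisted cubic to the curve whose
dual surface is the quartic. -/
def dualCoords (h2 : (2 : k) ≠ 0) : (Fin 4 → k) ≃ₗ[k] (Fin 4 → k) where
  toFun x := ![x 1, x 2, x 3 / 4, x 0 / 4]
  invFun y := ![4 * y 3, y 0, y 1, 4 * y 2]
  map_add' x y := by
    ext i
    fin_cases i <;> simp <;> ring
  map_smul' c x := by
    ext i
    fin_cases i <;> simp <;> ring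
  left_inv x := by
    have h4 := four_ne_zero_of_two_ne_zero h2
    ext i
    fin_cases i <;> simp <;> field_simp
  right_inv y := by
    have h4 := four_ne_zero_of_two_ne_zero h2
    ext i
    fin_cases i <;> simp <;> field_simp

/-- The coefficients of the binary cubic form that corresponds to a point of `k⁴`. -/
def assocCubic (y : Fin 4 → k) : Cubic k := ⟨y 3 / 4, y 0, y 1, y 2 / 4⟩

/-- The quarters in `assocCubic` account for the constants: `18/16 = 9/8` and `27/4⁴ = 27/16²`. -/
lemma eval_quarticP (h2 : (2 : k) ≠ 0) (y : Fin 4 → k) :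
    eval y (quarticP k) = -(assocCubic y).discr := by
  have h8 := eight_ne_zero_of_two_ne_zero h2
  have h4 := four_ne_zero_of_two_ne_zero h2
  have h16 := sixteen_ne_zero_of_two_ne_zero h2
  have e1 : (9 / 8 : k) = 18 / 16 := by field_simp; norm_num
  have e2 : (1 : k) / 16 ^ 2 = (1 / 4) ^ 4 := by field_simp; norm_num
  have e3 : (1 : k) / 16 = (1 / 4) ^ 2 := by field_simp; norm_num
  have e4 : (4 : k) * (1 / 4) = 1 := by field_simp
  simp only [quarticP, Cubic.discr, assocCubic, map_add, map_sub, map_neg, map_mul, map_pow,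
    eval_X, eval_C, e1]
  linear_combination (27 * (y 2 ^ 2 * y 3 ^ 2)) * e2 - (18 * y 0 * y 1 * y 2 * y 3) * e3 -
    (y 3 * y 1 ^ 3 + y 2 * y 0 ^ 3) * e4

lemma eval_quarticP_eq_cubicDisc (h2 : (2 : k) ≠ 0) (h3 : (3 : k) ≠ 0) (y : Fin 4 → k) :
    eval y (quarticP k) = 27 * cubicDisc ((singularCoords h2 h3).symm y) := by
  rw [eval_quarticP h2, ← neg_inj, neg_neg, ← neg_mul, ← cubicDisc_eq]
  congr 1
  simp [assocCubic, singularCoords]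
  constructor <;> field_simp

/-- A quadratic form in the three quadrics has zero gradient where they all vanish. For the
converse, `Q₀²` and `Q₂²` are, up to units, combinations of partial derivatives, and the equation
itself then gives `Q₁² = 0`. -/
lemma singular_iff (h2 : (2 : k) ≠ 0) (h3 : (3 : k) ≠ 0) (y : Fin 4 → k) :
    (eval y (quarticP k) = 0 ∧ ∀ i, eval y (pderiv i (quarticP k)) = 0) ↔
      ∀ i, quad ((singularCoords h2 h3).symm y) i = 0 := by
  have h4 := four_ne_zero_of_two_ne_zero h2
  have h8 := eight_ne_zero_of_two_ne_zero h2
  have h16 := sixteen_ne_zero_of_two_ne_zero h2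
  have h27 : (27 : k) ≠ 0 := by simpa [show (27 : k) = 3 ^ 3 by norm_num] using h3
  obtain ⟨A, hA⟩ : ∃ A, y 3 = 4 * A := ⟨y 3 / 4, by field_simp⟩
  obtain ⟨D, hD⟩ : ∃ D, y 2 = 4 * D := ⟨y 2 / 4, by field_simp⟩
  have c1 : (9 / 8 : k) * 16 = 18 := by field_simp; norm_num
  have c2 : (27 / 16 ^ 2 : k) * 256 = 27 := by field_simp; norm_num
  have d0 : eval y (pderiv 0 (quarticP k)) =
      -2 * y 0 * y 1 ^ 2 - 18 * y 1 * D * A + 12 * D * y 0 ^ 2 := by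
    simp [quarticP, pderiv_X, hA, hD]
    linear_combination (-(y 1 * D * A)) * c1
  have d1 : eval y (pderiv 1 (quarticP k)) =
      -2 * y 0 ^ 2 * y 1 - 18 * y 0 * D * A + 12 * A * y 1 ^ 2 := by
    simp [quarticP, pderiv_X, hA, hD]
    linear_combination (-(y 0 * D * A)) * c1
  have d2 : 4 * eval y (pderiv 2 (quarticP k)) =
      -(18 * y 0 * y 1 * A) + 4 * y 0 ^ 3 + 54 * (D * A ^ 2) := by
    simp [quarticP, pderiv_X, hA, hD]
    linear_combination (-(y 0 * y 1 * A)) * c1 + 2 * D * A ^ 2 * c2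
  have d3 : 4 * eval y (pderiv 3 (quarticP k)) =
      -(18 * y 0 * y 1 * D) + 4 * y 1 ^ 3 + 54 * (D ^ 2 * A) := by
    simp [quarticP, pderiv_X, hA, hD]
    linear_combination (-(y 0 * y 1 * D)) * c1 + 2 * D ^ 2 * A * c2
  rw [eval_quarticP_eq_cubicDisc h2 h3]
  set q := quad ((singularCoords h2 h3).symm y) with hq
  have c3 : (3 : k) * (1 / 3) = 1 := by field_simp
  have q0 : 9 * q 0 = 3 * A * y 1 - y 0 ^ 2 := by
    simp [hq, quad, singularCoords, hA]; field_simp; ring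
  have q1 : 9 * q 1 = 9 * A * D - y 0 * y 1 := by
    simp [hq, quad, singularCoords, hA, hD]; field_simp; ring
  have q2 : 9 * q 2 = 3 * D * y 0 - y 1 ^ 2 := by
    simp [hq, quad, singularCoords, hD]; field_simp; ring
  have hdisc : cubicDisc ((singularCoords h2 h3).symm y) = q 1 ^ 2 - 4 * q 0 * q 2 := rfl
  rw [hdisc]
  -- The constant that multiplies `Q₀²` and `Q₂²` below; it is invertible away from characteristics
  -- 2 and 3.
  have h12 : (12 * 9 ^ 2 : k) ≠ 0 := by
    rw [show (12 * 9 ^ 2 : k) = 4 * 3 ^ 5 by norm_num]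
    exact mul_ne_zero h4 (pow_ne_zero _ h3)
  constructor
  · rintro ⟨hP, hd⟩
    rw [hd] at d0 d1 d2 d3
    have z0 : q 0 = 0 := by
      have : 12 * 9 ^ 2 * q 0 ^ 2 = 0 := by
        linear_combination 12 * (9 * q 0 + 3 * A * y 1 - y 0 ^ 2) * q0 - 3 * y 0 * d2 - 9 * A * d1
      simpa using (mul_eq_zero.1 this).resolve_left h12
    have z2 : q 2 = 0 := by
      have : 12 * 9 ^ 2 * q 2 ^ 2 = 0 := by
        linear_combination 12 * (9 * q 2 + 3 * D * y 0 - y 1 ^ 2) * q2 - 3 * y 1 * d3 - 9 * D * d0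
      simpa using (mul_eq_zero.1 this).resolve_left h12
    have z1 : q 1 = 0 := by
      have := (mul_eq_zero.1 hP).resolve_left h27
      simpa [z0, z2] using this
    intro i
    fin_cases i
    exacts [z0, z1, z2]
  · intro h
    rw [h 0] at q0
    rw [h 1] at q1
    rw [h 2] at q2
    refine ⟨by simp [h], fun i => ?_⟩
    fin_cases i
    · change eval y (pderiv 0 _) = 0
      rw [d0]
      apply mul_left_cancel₀ h3
      linear_combination (2 * y 1 * q1 - 8 * y 0 * q2 + 12 * D * q0)
    · change eval y (pderiv 1 _) = 0
      rw [d1]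
      apply mul_left_cancel₀ h3
      linear_combination (2 * y 0 * q1 - 8 * y 1 * q0 + 12 * A * q2)
    · change eval y (pderiv 2 _) = 0
      apply mul_left_cancel₀ h4
      rw [d2]
      linear_combination (-6 * A * q1 + 4 * y 0 * q0)
    · change eval y (pderiv 3 _) = 0
      apply mul_left_cancel₀ h4
      rw [d3]
      linear_combination (-6 * D * q1 + 4 * y 1 * q2)

/-- The singular locus of the quartic is a twisted cubic. -/
lemma singularLocus_quarticP [IsAlgClosed k] (h2 : (2 : k) ≠ 0) (h3 : (3 : k) ≠ 0) :
    singularLocus (quarticP k) =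
      Projectivization.map (singularCoords h2 h3).toLinearMap (singularCoords h2 h3).injective ''
        standardTwistedCubic k := by
  ext x
  rw [mem_image_standardTwistedCubic]
  refine (singular_iff h2 h3 x.rep).trans ⟨fun h => ?_, ?_⟩
  · obtain ⟨s, t, e⟩ := exists_eq_cubicPt h
    refine ⟨s, t, ?_, ((singularCoords h2 h3).symm_apply_eq).1 e⟩
    by_contra! H
    rw [cubicPt_eq_zero_iff.2 H] at e
    exact x.rep_nonzero (by simpa using e)
  · rintro ⟨s, t, -, e⟩ i
    rw [e, LinearEquiv.symm_apply_apply, quad_cubicPt]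

lemma zeroLocus_eq_dualSurface [IsAlgClosed k] (h2 : (2 : k) ≠ 0) (h3 : (3 : k) ≠ 0) :
    zeroLocus (quarticP k) = dualSurface (Projectivization.map (dualCoords h2).toLinearMap
      (dualCoords h2).injective '' standardTwistedCubic k) := by
  ext x
  rw [mem_dualSurface_iff h2 h3 (dualCoords h2) x (assocCubic x.rep)]
  · change eval x.rep _ = 0 ↔ _
    rw [eval_quarticP h2, neg_eq_zero]
  · intro v
    simp [dualCoords, assocCubic, dotProduct, Fin.sum_univ_four]
    ring

lemma zeroLocus_eq_tangentialDevelopable [IsAlgClosed k] (h2 : (2 : k) ≠ 0) (h3 : (3 : k) ≠ 0) :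
    zeroLocus (quarticP k) = tangentialDevelopable (singularLocus (quarticP k)) := by
  have h27 : (27 : k) ≠ 0 := by simpa [show (27 : k) = 3 ^ 3 by norm_num] using h3
  ext x
  rw [singularLocus_quarticP h2 h3, mem_tangentialDevelopable_iff h2 h3]
  change eval x.rep _ = 0 ↔ _
  rw [eval_quarticP_eq_cubicDisc h2 h3, mul_eq_zero, or_iff_right h27]

end Coordinates

/-! ### The discriminant surface of binary cubic forms -/

section BinaryCubicForms

/-- The binary cubic form with given coefficients. -/
def formOfCubic (P : Cubic k) : MvPolynomial (Fin 2) k :=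
  C P.a * X 0 ^ 3 + C P.b * (X 0 ^ 2 * X 1) + C P.c * (X 0 * X 1 ^ 2) + C P.d * X 1 ^ 3

lemma formOfCubic_isHomogeneous (P : Cubic k) : (formOfCubic P).IsHomogeneous 3 := by
  have hX := fun i : Fin 2 => isHomogeneous_X k i
  exact (((((hX 0).pow 3).C_mul _).add ((((hX 0).pow 2).mul (hX 1)).C_mul _)).add
    (((hX 0).mul ((hX 1).pow 2)).C_mul _)).add (((hX 1).pow 3).C_mul _)

lemma formOfCubic_eq_monomials (P : Cubic k) : formOfCubic P =
    monomial (Finsupp.single 0 3) P.a + monomial (Finsupp.single 0 2 + Finsupp.single 1 1) P.b +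
    monomial (Finsupp.single 0 1 + Finsupp.single 1 2) P.c + monomial (Finsupp.single 1 3) P.d := by
  have e : ∀ (i j : ℕ) (c : k), monomial (Finsupp.single (0 : Fin 2) i + Finsupp.single 1 j) c =
      C c * (X 0 ^ i * X 1 ^ j) := by
    intro i j c
    rw [X_pow_eq_monomial, X_pow_eq_monomial, monomial_mul, C_mul_monomial]
    simp
  have e3 := e 3 0 P.a
  have e0 := e 0 3 P.d
  simp only [Finsupp.single_zero, add_zero, zero_add, pow_zero, mul_one, one_mul] at e3 e0
  rw [e, e, e3, e0, formOfCubic, pow_one, pow_one]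

lemma toCubic_formOfCubic (P : Cubic k) (h : formOfCubic P ∈ homogeneousSubmodule (Fin 2) k 3) :
    BinaryCubicForm.toCubic ⟨formOfCubic P, h⟩ = P := by
  ext <;> simp [BinaryCubicForm.toCubic, formOfCubic_eq_monomials, coeff_monomial,
    Finsupp.ext_iff, Fin.forall_fin_two]

lemma formOfCubic_toCubic (f : BinaryCubicForm k) : formOfCubic f.toCubic = f.1 := by
  ext m
  by_cases hm : m 0 + m 1 = 3
  · have : (m 0 = 3 ∧ m 1 = 0) ∨ (m 0 = 2 ∧ m 1 = 1) ∨ (m 0 = 1 ∧ m 1 = 2) ∨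
        (m 0 = 0 ∧ m 1 = 3) := by omega
    rw [formOfCubic_eq_monomials]
    rcases this with h | h | h | h
    · have : m = Finsupp.single 0 3 := by ext i; fin_cases i <;> simp [h]
      subst this
      simp [BinaryCubicForm.toCubic, coeff_monomial, Finsupp.ext_iff, Fin.forall_fin_two]
    · have : m = Finsupp.single 0 2 + Finsupp.single 1 1 := by ext i; fin_cases i <;> simp [h]
      subst this
      simp [BinaryCubicForm.toCubic, coeff_monomial, Finsupp.ext_iff, Fin.forall_fin_two]
    · have : m = Finsupp.single 0 1 + Finsupp.single 1 2 := by ext i; fin_cases i <;> simp [h]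
      subst this
      simp [BinaryCubicForm.toCubic, coeff_monomial, Finsupp.ext_iff, Fin.forall_fin_two]
    · have : m = Finsupp.single 1 3 := by ext i; fin_cases i <;> simp [h]
      subst this
      simp [BinaryCubicForm.toCubic, coeff_monomial, Finsupp.ext_iff, Fin.forall_fin_two]
  · have hd : m.degree ≠ 3 := by
      rwa [Finsupp.degree_eq_sum, Fin.sum_univ_two]
    rw [(formOfCubic_isHomogeneous _).coeff_eq_zero hd,
      ((mem_homogeneousSubmodule _ _).1 f.2).coeff_eq_zero hd]

/-- The linear isomorphism from `k⁴` to the space of binary cubic forms under which the quartic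
is the discriminant. -/
def cubicFormEquiv (h2 : (2 : k) ≠ 0) : (Fin 4 → k) ≃ₗ[k] BinaryCubicForm k where
  toFun y := ⟨formOfCubic (assocCubic y), formOfCubic_isHomogeneous _⟩
  invFun f := ![f.toCubic.b, f.toCubic.c, 4 * f.toCubic.d, 4 * f.toCubic.a]
  map_add' x y := by
    ext1
    simp [formOfCubic, assocCubic, add_div]
    ring
  map_smul' c x := by
    ext1
    simp [formOfCubic, assocCubic, mul_div_assoc, smul_eq_C_mul]
    ring
  left_inv y := by
    have h4 := four_ne_zero_of_two_ne_zero h2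
    have h := toCubic_formOfCubic (assocCubic y) (formOfCubic_isHomogeneous _)
    simp only [h]
    ext i
    fin_cases i <;> simp [assocCubic] <;> field_simp
  right_inv f := by
    have h4 := four_ne_zero_of_two_ne_zero h2
    ext1
    rw [← formOfCubic_toCubic f]
    ext <;> simp [assocCubic] <;> field_simp

lemma toCubic_cubicFormEquiv (h2 : (2 : k) ≠ 0) (y : Fin 4 → k) :
    (cubicFormEquiv h2 y).toCubic = assocCubic y := toCubic_formOfCubic _ _

lemma exists_linear_eq {l : MvPolynomial (Fin 2) k} (hl : l.IsHomogeneous 1) :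
    ∃ m n : k, l = C m * X 0 + C n * X 1 := by
  have := (mem_homogeneousSubmodule _ _).2 hl
  rw [homogeneousSubmodule_one_eq_span_X, Submodule.mem_span_range_iff_exists_fun] at this
  obtain ⟨c, rfl⟩ := this
  exact ⟨c 0, c 1, by simp [smul_eq_C_mul]⟩

/-- A binary cubic form has a multiple root if and only if its discriminant vanishes. -/
lemma discr_eq_zero_iff_exists_sq_dvd (h2 : (2 : k) ≠ 0) (h3 : (3 : k) ≠ 0) (P : Cubic k) :
    P.discr = 0 ↔ ∃ l : MvPolynomial (Fin 2) k, l.IsHomogeneous 1 ∧ l ≠ 0 ∧ l ^ 2 ∣ formOfCubic P := by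
  rw [discr_eq_zero_iff_exists_double_root h2 h3]
  constructor
  · rintro ⟨S, T, hST, e1, e2⟩
    obtain ⟨m, n, rfl⟩ := exists_factor_of_double_root h3 hST e1 e2
    refine ⟨C T * X 0 - C S * X 1, (isHomogeneous_C_mul_X _ _).sub (isHomogeneous_C_mul_X _ _),
      fun h => ?_, C m * X 0 + C n * X 1, ?_⟩
    · have hT := congrArg (eval ![1, 0]) h
      have hS := congrArg (eval ![0, 1]) h
      simp at hT hS
      tauto
    · simp only [formOfCubic, map_sub, map_mul, map_pow,
        show (C 2 : MvPolynomial (Fin 2) k) = 2 from map_ofNat C 2]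
      ring
  · rintro ⟨l, hl, hl0, q, hq⟩
    obtain ⟨m, n, rfl⟩ := exists_linear_eq hl
    -- The point `(n : -m)` is the zero of the linear form `m s + n t`; both partial derivatives of
    -- a multiple of its square vanish there.
    refine ⟨n, -m, ?_, ?_, ?_⟩
    · by_contra! H
      apply hl0
      have hm : m = 0 := by simpa using H.2
      simp [hm, H.1]
    · have := congrArg (fun f => eval ![n, -m] (pderiv 0 f)) hq
      simp [formOfCubic, pderiv_X] at this
      linear_combination this
    · have := congrArg (fun f => eval ![n, -m] (pderiv 1 f)) hq
      simp [formOfCubic, pderiv_X] at this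
      linear_combination this

/-- Homogeneity makes the vanishing of the discriminant independent of the representative of a
projective point. -/
lemma discr_formOfCubic_smul (a : k) (f : BinaryCubicForm k) :
    (a • f).toCubic.discr = a ^ 4 * f.toCubic.discr := by
  simp [BinaryCubicForm.toCubic, Cubic.discr]
  ring

lemma mem_discriminantSurface_iff (h2 : (2 : k) ≠ 0) (h3 : (3 : k) ≠ 0)
    (f : ℙ k (BinaryCubicForm k)) :
    f ∈ discriminantSurface k ↔ f.rep.toCubic.discr = 0 := by
  rw [discr_eq_zero_iff_exists_sq_dvd h2 h3, formOfCubic_toCubic]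
  rfl

lemma exists_map_rep {V W : Type*} [AddCommGroup V] [Module k V] [AddCommGroup W] [Module k W]
    (e : V ≃ₗ[k] W) (x : ℙ k V) :
    ∃ a : k, a ≠ 0 ∧ (Projectivization.map e.toLinearMap e.injective x).rep = a • e x.rep := by
  have hmk : Projectivization.map e.toLinearMap e.injective x =
      Projectivization.mk k (e x.rep) (by simpa using x.rep_nonzero) := by
    conv_lhs => rw [← x.mk_rep]
    exact Projectivization.map_mk _ _ _ _
  obtain ⟨a, ha⟩ := Projectivization.exists_smul_eq_mk_rep k (e x.rep)
    (by simpa using x.rep_nonzero)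
  exact ⟨a, a.ne_zero, by rw [hmk, ← ha, Units.smul_def]⟩

lemma map_linearEquiv_surjective {V W : Type*} [AddCommGroup V] [Module k V] [AddCommGroup W]
    [Module k W] (e : V ≃ₗ[k] W) :
    Function.Surjective (Projectivization.map e.toLinearMap e.injective) := by
  intro f
  refine ⟨Projectivization.mk k (e.symm f.rep) (by simpa using f.rep_nonzero), ?_⟩
  rw [Projectivization.map_mk]
  conv_rhs => rw [← f.mk_rep]
  congr 1
  exact e.apply_symm_apply _

lemma mem_zeroLocus_iff_map_mem (h2 : (2 : k) ≠ 0) (h3 : (3 : k) ≠ 0) (x : ℙ k (Fin 4 → k)) :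
    x ∈ zeroLocus (quarticP k) ↔
      Projectivization.map (cubicFormEquiv h2).toLinearMap (cubicFormEquiv h2).injective x ∈
        discriminantSurface k := by
  obtain ⟨a, ha, e⟩ := exists_map_rep (cubicFormEquiv h2) x
  rw [mem_discriminantSurface_iff h2 h3, e, discr_formOfCubic_smul, toCubic_cubicFormEquiv,
    mul_eq_zero, or_iff_right (pow_ne_zero _ ha), ← neg_eq_zero, ← eval_quarticP h2]
  exact Iff.rfl

lemma image_zeroLocus_eq_discriminantSurface (h2 : (2 : k) ≠ 0) (h3 : (3 : k) ≠ 0) :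
    Projectivization.map (cubicFormEquiv h2).toLinearMap (cubicFormEquiv h2).injective ''
      zeroLocus (quarticP k) = discriminantSurface k := by
  ext f
  constructor
  · rintro ⟨x, hx, rfl⟩
    exact (mem_zeroLocus_iff_map_mem h2 h3 x).1 hx
  · intro hf
    obtain ⟨x, rfl⟩ := map_linearEquiv_surjective (cubicFormEquiv h2) f
    exact ⟨x, (mem_zeroLocus_iff_map_mem h2 h3 x).2 hf, rfl⟩

end BinaryCubicForms

/-! ### Plane charts under changes of coordinates -/

section PlaneCharts

/-- The section of the surface `F = 0` by the plane `h` has an ordinary cusp at the point with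
homogeneous coordinates `p`. -/
def HasCuspAt (F : MvPolynomial (Fin 4) k) (h p : Fin 4 → k) : Prop :=
  ∃ q r : Fin 4 → k, LinearIndependent k ![p, q, r] ∧
    h ⬝ᵥ p = 0 ∧ h ⬝ᵥ q = 0 ∧ h ⬝ᵥ r = 0 ∧ IsOrdinaryCuspAtOrigin (planeChart F p q r)

lemma sectionHasCuspAt_iff (F : MvPolynomial (Fin 4) k) (h : Fin 4 → k) (x : ℙ k (Fin 4 → k)) :
    SectionHasCuspAt F h x ↔ HasCuspAt F h x.rep := Iff.rfl

lemma planeChart_compLinear (F : MvPolynomial (Fin 4) k) (g : (Fin 4 → k) ≃ₗ[k] (Fin 4 → k))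
    (p q r : Fin 4 → k) :
    planeChart (compLinear F g) p q r = planeChart F (g p) (g q) (g r) := by
  rw [planeChart, aeval_compLinear, planeChart]
  congr 2
  funext i
  rw [linearEquiv_apply_eq_sum g p, linearEquiv_apply_eq_sum g q, linearEquiv_apply_eq_sum g r]
  simp only [map_sum, Finset.sum_mul, ← Finset.sum_add_distrib, algebraMap_eq, map_mul]
  exact Finset.sum_congr rfl fun j _ => by ring

lemma HasCuspAt.compLinear {F : MvPolynomial (Fin 4) k} {g : (Fin 4 → k) ≃ₗ[k] (Fin 4 → k)}
    {h h' p : Fin 4 → k} (hc : HasCuspAt F h (g p)) (hh : ∀ v, h' ⬝ᵥ v = h ⬝ᵥ g v) :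
    HasCuspAt (compLinear F g) h' p := by
  obtain ⟨q, r, hli, h0, h1, h2, hcusp⟩ := hc
  refine ⟨g.symm q, g.symm r, ?_, ?_, ?_, ?_, ?_⟩
  · have := hli.map' g.symm.toLinearMap g.symm.ker
    convert! this using 1
    ext i
    fin_cases i <;> simp
  · rw [hh, h0]
  · rw [hh, g.apply_symm_apply, h1]
  · rw [hh, g.apply_symm_apply, h2]
  · rwa [planeChart_compLinear, g.apply_symm_apply, g.apply_symm_apply]

lemma eval_planeChart (F : MvPolynomial (Fin 4) k) (p q r : Fin 4 → k) (y : Fin 2 → k) :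
    eval y (planeChart F p q r) = eval (p + y 0 • q + y 1 • r) F := by
  have : (aeval y) (planeChart F p q r) = aeval (p + y 0 • q + y 1 • r) F := by
    rw [planeChart, ← AlgHom.comp_apply]
    congr 1
    ext i
    simp [mul_comm]
  exact this

lemma planeChart_smul [Infinite k] {F : MvPolynomial (Fin 4) k} {d : ℕ} (hF : F.IsHomogeneous d)
    (a : k) (p q r : Fin 4 → k) :
    planeChart F (a • p) (a • q) (a • r) = C (a ^ d) * planeChart F p q r := by
  refine MvPolynomial.funext fun y => ?_
  rw [map_mul, eval_C, eval_planeChart, eval_planeChart, ← hF.eval_smul]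
  congr 2
  simp only [smul_add, smul_comm a]

lemma IsOrdinaryCuspAtOrigin.of_C_mul {f : MvPolynomial (Fin 2) k} {a : k} (ha : a ≠ 0)
    (h : IsOrdinaryCuspAtOrigin (C a * f)) : IsOrdinaryCuspAtOrigin f := by
  obtain ⟨h0, h1, l, hl, hl0, ⟨c, hc, h2⟩, h3⟩ := h
  have hu : IsUnit (C a : MvPolynomial (Fin 2) k) := (IsUnit.mk0 a ha).map C
  rw [homogeneousComponent_C_mul] at h0 h1 h2 h3
  refine ⟨(mul_eq_zero.1 h0).resolve_left hu.ne_zero, (mul_eq_zero.1 h1).resolve_left hu.ne_zero,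
    l, hl, hl0, ⟨a⁻¹ * c, mul_ne_zero (inv_ne_zero ha) hc, ?_⟩, fun h => h3 (h.mul_left _)⟩
  apply hu.mul_left_cancel
  rw [h2, ← mul_assoc, ← C_mul, mul_inv_cancel_left₀ ha]

/-- Scaling all three chart vectors multiplies the equation by a unit; dividing `q` and `r` by `a`
reduces a scaling of `p` alone to this case. -/
lemma HasCuspAt.of_smul [Infinite k] {F : MvPolynomial (Fin 4) k} {d : ℕ} (hF : F.IsHomogeneous d)
    {h p : Fin 4 → k} {a : k} (ha : a ≠ 0) (hc : HasCuspAt F h (a • p)) : HasCuspAt F h p := by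
  obtain ⟨q, r, hli, h0, h1, h2, hcusp⟩ := hc
  have hq : q = a • a⁻¹ • q := by rw [smul_inv_smul₀ ha]
  have hr : r = a • a⁻¹ • r := by rw [smul_inv_smul₀ ha]
  refine ⟨a⁻¹ • q, a⁻¹ • r, ?_, ?_, ?_, ?_, ?_⟩
  · have := hli.units_smul fun _ => (Units.mk0 a ha)⁻¹
    convert! this using 1
    ext i j
    fin_cases i <;> simp [Units.smul_def, ha]
  · simpa [ha] using h0
  · simp [h1]
  · simp [h2]
  · rw [hq, hr, planeChart_smul hF] at hcusp
    exact hcusp.of_C_mul (pow_ne_zero _ ha)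

end PlaneCharts

/-! ### Quadratic forms in the three quadrics, expanded in a plane chart -/

section QuadraticInQuadrics

/-- The quartic form `∑ Mᵢⱼ Qᵢ Qⱼ` in the three quadrics through the twisted cubic. -/
def quadQuartic (M : Matrix (Fin 3) (Fin 3) k) : MvPolynomial (Fin 4) k :=
  ∑ i, ∑ j, C (M i j) * (quad X i * quad X j)

lemma eval_quadQuartic (M : Matrix (Fin 3) (Fin 3) k) (x : Fin 4 → k) :
    eval x (quadQuartic M) = ∑ i, ∑ j, M i j * (quad x i * quad x j) := by
  have : ∀ i, eval x (quad X i) = quad x i := by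
    intro i
    fin_cases i <;> simp [quad]
  simp [quadQuartic, this]

lemma quad_add {A : Type*} [CommRing A] (p w : Fin 4 → A) (i : Fin 3) :
    quad (p + w) i = quad p i + (polarQuad p w i + quad w i) := by
  fin_cases i <;> simp [quad, polarQuad] <;> ring

/-- The displacement vector in a plane chart. -/
def chartVector (q r : Fin 4 → k) : Fin 4 → MvPolynomial (Fin 2) k :=
  fun i => C (q i) * X 0 + C (r i) * X 1

/-- The linear part of a quadric through the twisted cubic in a plane chart. -/
def chartLinear (p q r : Fin 4 → k) (i : Fin 3) : MvPolynomial (Fin 2) k :=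
  C (polarQuad p q i) * X 0 + C (polarQuad p r i) * X 1

lemma chartLinear_isHomogeneous (p q r : Fin 4 → k) (i : Fin 3) :
    (chartLinear p q r i).IsHomogeneous 1 :=
  (isHomogeneous_C_mul_X _ _).add (isHomogeneous_C_mul_X _ _)

lemma quad_chartVector_isHomogeneous (q r : Fin 4 → k) (i : Fin 3) :
    (quad (chartVector q r) i).IsHomogeneous 2 := by
  have h : ∀ i, (chartVector q r i).IsHomogeneous 1 := fun i =>
    (isHomogeneous_C_mul_X _ _).add (isHomogeneous_C_mul_X _ _)
  fin_cases i
  · exact ((h 0).mul (h 2)).sub ((h 1).pow 2)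
  · exact ((h 0).mul (h 3)).sub ((h 1).mul (h 2))
  · exact ((h 1).mul (h 3)).sub ((h 2).pow 2)

lemma aeval_quad_planeChart {p : Fin 4 → k} (hp : ∀ i, quad p i = 0) (q r : Fin 4 → k)
    (i : Fin 3) :
    aeval (fun i => C (p i) + C (q i) * X 0 + C (r i) * X 1 : Fin 4 → MvPolynomial (Fin 2) k)
      (quad (X : Fin 4 → MvPolynomial (Fin 4) k) i) =
      chartLinear p q r i + quad (chartVector q r) i := by
  have e1 : aeval (fun i => C (p i) + C (q i) * X 0 + C (r i) * X 1 :
      Fin 4 → MvPolynomial (Fin 2) k) (quad (X : Fin 4 → MvPolynomial (Fin 4) k) i) =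
      quad ((fun i => C (p i)) + chartVector q r) i := by
    fin_cases i <;> simp [quad, chartVector, add_assoc]
  have e2 : quad (fun i => C (p i) : Fin 4 → MvPolynomial (Fin 2) k) i = C (quad p i) := by
    fin_cases i <;> simp [quad]
  have e3 : polarQuad (fun i => C (p i)) (chartVector q r) i = chartLinear p q r i := by
    fin_cases i <;> simp [polarQuad, chartVector, chartLinear,
      show (C 2 : MvPolynomial (Fin 2) k) = 2 from map_ofNat C 2] <;> ring
  rw [e1, quad_add, e2, e3, hp, C_0, zero_add]

/-- The quadratic part of `quadQuartic M` in a plane chart at a point of the twisted cubic. -/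
def chartQuadratic (M : Matrix (Fin 3) (Fin 3) k) (p q r : Fin 4 → k) : MvPolynomial (Fin 2) k :=
  ∑ i, ∑ j, C (M i j) * (chartLinear p q r i * chartLinear p q r j)

/-- The cubic part of `quadQuartic M` in a plane chart at a point of the twisted cubic. -/
def chartCubic (M : Matrix (Fin 3) (Fin 3) k) (p q r : Fin 4 → k) : MvPolynomial (Fin 2) k :=
  ∑ i, ∑ j, C (M i j) * (chartLinear p q r i * quad (chartVector q r) j +
    quad (chartVector q r) i * chartLinear p q r j)

/-- On the curve each quadric has no constant term in the chart, so it is a linear part plus a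
quadratic part; multiplying out leaves only degrees 2, 3 and 4. -/
lemma homogeneousComponent_planeChart (M : Matrix (Fin 3) (Fin 3) k) {p : Fin 4 → k}
    (hp : ∀ i, quad p i = 0) (q r : Fin 4 → k) :
    homogeneousComponent 0 (planeChart (quadQuartic M) p q r) = 0 ∧
    homogeneousComponent 1 (planeChart (quadQuartic M) p q r) = 0 ∧
    homogeneousComponent 2 (planeChart (quadQuartic M) p q r) = chartQuadratic M p q r ∧
    homogeneousComponent 3 (planeChart (quadQuartic M) p q r) = chartCubic M p q r := by
  set A4 : MvPolynomial (Fin 2) k :=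
    ∑ i, ∑ j, C (M i j) * (quad (chartVector q r) i * quad (chartVector q r) j) with hA4
  have hL := chartLinear_isHomogeneous p q r
  have hN := quad_chartVector_isHomogeneous q r
  have h2 : chartQuadratic M p q r ∈ homogeneousSubmodule (Fin 2) k 2 :=
    IsHomogeneous.sum _ _ _ fun i _ => IsHomogeneous.sum _ _ _ fun j _ =>
      ((hL i).mul (hL j)).C_mul _
  have h3 : chartCubic M p q r ∈ homogeneousSubmodule (Fin 2) k 3 :=
    IsHomogeneous.sum _ _ _ fun i _ => IsHomogeneous.sum _ _ _ fun j _ =>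
      (((hL i).mul (hN j)).add ((hN i).mul (hL j))).C_mul _
  have h4 : A4 ∈ homogeneousSubmodule (Fin 2) k 4 :=
    IsHomogeneous.sum _ _ _ fun i _ => IsHomogeneous.sum _ _ _ fun j _ =>
      ((hN i).mul (hN j)).C_mul _
  have e : planeChart (quadQuartic M) p q r = chartQuadratic M p q r + chartCubic M p q r + A4 := by
    simp only [planeChart, quadQuartic, map_sum, map_mul, aeval_quad_planeChart hp, aeval_C,
      algebraMap_eq, chartQuadratic, chartCubic, hA4, ← Finset.sum_add_distrib]
    exact Finset.sum_congr rfl fun i _ => Finset.sum_congr rfl fun j _ => by ring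
  rw [e]
  simp only [map_add, homogeneousComponent_of_mem h2, homogeneousComponent_of_mem h3,
    homogeneousComponent_of_mem h4]
  simp

lemma isOrdinaryCuspAtOrigin_quadQuartic_iff (M : Matrix (Fin 3) (Fin 3) k) {p : Fin 4 → k}
    (hp : ∀ i, quad p i = 0) (q r : Fin 4 → k) :
    IsOrdinaryCuspAtOrigin (planeChart (quadQuartic M) p q r) ↔
      ∃ l : MvPolynomial (Fin 2) k, l.IsHomogeneous 1 ∧ l ≠ 0 ∧
        (∃ c : k, c ≠ 0 ∧ chartQuadratic M p q r = C c * l ^ 2) ∧ ¬ l ∣ chartCubic M p q r := by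
  obtain ⟨h0, h1, h2, h3⟩ := homogeneousComponent_planeChart M hp q r
  rw [IsOrdinaryCuspAtOrigin, h2, h3]
  simp only [h0, h1, true_and]

end QuadraticInQuadrics

/-! ### The singular curve of the quartic is cuspidal -/

section CuspsOfTheQuartic

/-- The symmetric matrix of the quadratic form `27 (Q₁² - 4 Q₀ Q₂)`. -/
def discMatrix (k : Type*) [Field k] : Matrix (Fin 3) (Fin 3) k :=
  !![0, 0, -54; 0, 27, 0; -54, 0, 0]

lemma quarticP_eq_compLinear [Infinite k] (h2 : (2 : k) ≠ 0) (h3 : (3 : k) ≠ 0) :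
    quarticP k = compLinear (quadQuartic (discMatrix k)) (singularCoords h2 h3).symm := by
  refine MvPolynomial.funext fun y => ?_
  rw [eval_quarticP_eq_cubicDisc h2 h3, eval_compLinear, eval_quadQuartic]
  simp [Fin.sum_univ_succ, discMatrix, cubicDisc]
  ring

/-- The linear form that defines the osculating plane of the twisted cubic. -/
def oscForm {A : Type*} [CommRing A] (s t : A) (w : Fin 4 → A) : A :=
  -t ^ 3 * w 0 + 3 * s * t ^ 2 * w 1 - 3 * s ^ 2 * t * w 2 + s ^ 3 * w 3

/-- The image of the differential of the quadrics is a tangent plane of the cone `v₁² = 4 v₀ v₂`, so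
the form degenerates to a square there. The tangent cone of the surface is thus the osculating
plane, counted twice. -/
lemma polarQuad_cubicPt_disc (s t : k) (w : Fin 4 → k) :
    polarQuad (cubicPt s t) w 1 ^ 2 - 4 * polarQuad (cubicPt s t) w 0 * polarQuad (cubicPt s t) w 2
      = oscForm s t w ^ 2 := by
  simp [polarQuad, cubicPt, oscForm]; ring

lemma polarQuad_cubicPt_disc₂ (s t : k) (v w : Fin 4 → k) :
    polarQuad (cubicPt s t) v 1 * polarQuad (cubicPt s t) w 1 -
      2 * polarQuad (cubicPt s t) v 0 * polarQuad (cubicPt s t) w 2 -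
      2 * polarQuad (cubicPt s t) v 2 * polarQuad (cubicPt s t) w 0
      = oscForm s t v * oscForm s t w := by
  simp [polarQuad, cubicPt, oscForm]; ring

/-- The direction `q` lies in the osculating plane and `r` does not, so the tangent cone of the
section is `X 1 = 0` doubled. The hypothesis `hcub` says that the cubic part is nonzero along `q`.
-/
lemma hasCuspAt_of_directions (h2 : (2 : k) ≠ 0) (h3 : (3 : k) ≠ 0) {s t : k} (hst : s ≠ 0 ∨ t ≠ 0)
    {h q r : Fin 4 → k} (hp0 : h ⬝ᵥ cubicPt s t = 0) (hq0 : h ⬝ᵥ q = 0) (hr0 : h ⬝ᵥ r = 0)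
    (hq : oscForm s t q = 0) (hr : oscForm s t r ≠ 0)
    (hcub : polarQuad (cubicPt s t) q 1 * quad q 1 - 2 * polarQuad (cubicPt s t) q 0 * quad q 2 -
      2 * polarQuad (cubicPt s t) q 2 * quad q 0 ≠ 0) :
    HasCuspAt (quadQuartic (discMatrix k)) h (cubicPt s t) := by
  have h27 : (27 : k) ≠ 0 := by simpa [show (27 : k) = 3 ^ 3 by norm_num] using h3
  have hp := quad_cubicPt s t
  refine ⟨q, r, ?_, hp0, hq0, hr0, (isOrdinaryCuspAtOrigin_quadQuartic_iff _ hp q r).2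
    ⟨X 1, isHomogeneous_X _ _, X_ne_zero _, ⟨27 * oscForm s t r ^ 2,
      mul_ne_zero h27 (pow_ne_zero _ hr), ?_⟩, ?_⟩⟩
  -- The osculating form kills `p` and `q` but not `r`; the polars with `p` kill `p`, but by `hcub`
  -- not all of them kill `q`.
  · rw [Fintype.linearIndependent_iff]
    intro c hc
    rw [Fin.sum_univ_three] at hc
    simp only [Matrix.cons_val] at hc
    have hosc : ∀ a b d : k, oscForm s t (a • cubicPt s t + b • q + d • r) =
        b * oscForm s t q + d * oscForm s t r := by
      intro a b d
      simp [oscForm, cubicPt, Matrix.vecHead, Matrix.vecTail]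
      ring
    have hpol : ∀ (a b : k) i, polarQuad (cubicPt s t) (a • cubicPt s t + b • q) i =
        b * polarQuad (cubicPt s t) q i := by
      intro a b i
      fin_cases i <;> simp [polarQuad, cubicPt] <;> ring
    have hc2 : c 2 = 0 := by
      have := hosc (c 0) (c 1) (c 2)
      rw [hc, hq, show oscForm s t (0 : Fin 4 → k) = 0 by simp [oscForm], mul_zero, zero_add] at this
      exact (mul_eq_zero.1 this.symm).resolve_right hr
    have hc1 : c 1 = 0 := by
      by_contra hne
      rw [hc2, zero_smul, add_zero] at hc
      have hz : ∀ i, polarQuad (cubicPt s t) q i = 0 := by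
        intro i
        have := hpol (c 0) (c 1) i
        rw [hc] at this
        refine (mul_eq_zero.1 (this.symm.trans ?_)).resolve_left hne
        fin_cases i <;> simp [polarQuad]
      exact hcub (by simp [hz])
    have hc0 : c 0 = 0 := by
      rw [hc2, hc1, zero_smul, zero_smul, add_zero, add_zero] at hc
      exact (smul_eq_zero.1 hc).resolve_right (cubicPt_ne_zero hst)
    intro i
    fin_cases i
    exacts [hc0, hc1, hc2]
  · have e1 := polarQuad_cubicPt_disc s t q
    have e2 := polarQuad_cubicPt_disc s t r
    have e3 := polarQuad_cubicPt_disc₂ s t q r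
    rw [hq] at e1 e3
    simp only [chartQuadratic, chartLinear, Fin.sum_univ_three, discMatrix, Matrix.of_apply,
      Matrix.cons_val, map_neg, map_zero, map_mul, map_pow, ← e2, map_sub,
      map_ofNat (C : k →+* MvPolynomial (Fin 2) k)]
    have e1' := congrArg (C : k →+* MvPolynomial (Fin 2) k) e1
    have e3' := congrArg (C : k →+* MvPolynomial (Fin 2) k) e3
    simp only [map_sub, map_mul, map_pow, map_zero,
      map_ofNat (C : k →+* MvPolynomial (Fin 2) k)] at e1' e3'
    linear_combination (27 * X 0 ^ 2) * e1' + (54 * X 0 * X 1) * e3'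
  · rintro ⟨f, hf⟩
    -- If `X 1` divided the cubic part, it would vanish at `(1, 0)`; its value there is `54` times
    -- the quantity in `hcub`.
    have := congrArg (eval ![1, 0]) hf
    have hN : ∀ i, eval ![1, 0] (quad (chartVector q r) i) = quad q i := by
      intro i
      fin_cases i <;> simp [quad, chartVector]
    simp [chartCubic, chartLinear, Fin.sum_univ_succ, discMatrix, hN] at this
    apply hcub
    apply mul_left_cancel₀ (mul_ne_zero h2 h27)
    linear_combination this

/-- The plane section of the tangential developable of the twisted cubic by a plane that is
transversal to the curve has an ordinary cusp. -/
lemma hasCuspAt_of_transversal (h2 : (2 : k) ≠ 0) (h3 : (3 : k) ≠ 0) {s t : k}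
    (hst : s ≠ 0 ∨ t ≠ 0) {h : Fin 4 → k} (hp : h ⬝ᵥ cubicPt s t = 0)
    (ht : ¬ (h ⬝ᵥ cubicDs s t = 0 ∧ h ⬝ᵥ cubicDt s t = 0)) :
    HasCuspAt (quadQuartic (discMatrix k)) h (cubicPt s t) := by
  -- Euler's relation: transversality forces `h` to be nonzero on `cubicDs` if `s = 0` and on
  -- `cubicDt` if `s ≠ 0`.
  have htan : s * (h ⬝ᵥ cubicDs s t) + t * (h ⬝ᵥ cubicDt s t) = 0 := by
    rw [← smul_eq_mul, ← smul_eq_mul, ← dotProduct_smul, ← dotProduct_smul, ← dotProduct_add,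
      cubicPt_eq_tangent, dotProduct_smul, hp, smul_zero]
  by_cases hs : s = 0
  · have ht0 : t ≠ 0 := by tauto
    have hd : h ⬝ᵥ cubicDs s t ≠ 0 := by
      intro H
      rw [H] at htan
      exact ht ⟨H, by simpa [ht0] using htan⟩
    -- The vector `(3s, t, 0, 0)` is half the second derivative in `s`, so it lies in the osculating
    -- plane, and `(1, 0, 0, 0)` lies outside. A multiple of the tangent vector moves each into the
    -- plane `h`.
    refine hasCuspAt_of_directions h2 h3 hst
      (q := ![3 * s, t, 0, 0] - (h ⬝ᵥ ![3 * s, t, 0, 0] / h ⬝ᵥ cubicDs s t) • cubicDs s t)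
      (r := ![1, 0, 0, 0] - (h ⬝ᵥ ![1, 0, 0, 0] / h ⬝ᵥ cubicDs s t) • cubicDs s t) hp ?_ ?_ ?_ ?_ ?_
    · rw [dotProduct_sub, dotProduct_smul, smul_eq_mul, div_mul_cancel₀ _ hd, sub_self]
    · rw [dotProduct_sub, dotProduct_smul, smul_eq_mul, div_mul_cancel₀ _ hd, sub_self]
    · simp [oscForm, cubicDs]; ring
    · generalize h ⬝ᵥ ![1, 0, 0, 0] / h ⬝ᵥ cubicDs s t = c
      have : oscForm s t (![1, 0, 0, 0] - c • cubicDs s t) = -t ^ 3 := by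
        simp [oscForm, cubicDs]; ring
      rw [this]
      exact neg_ne_zero.2 (pow_ne_zero _ ht0)
    · generalize h ⬝ᵥ ![3 * s, t, 0, 0] / h ⬝ᵥ cubicDs s t = c
      convert! mul_ne_zero h2 (pow_ne_zero 6 ht0) using 1
      simp [polarQuad, quad, cubicDs, cubicPt]; ring
  · have hd : h ⬝ᵥ cubicDt s t ≠ 0 := by
      intro H
      rw [H] at htan
      exact ht ⟨by simpa [hs] using htan, H⟩
    -- The same with half the second derivative in `t`, namely `(0, 0, s, 3t)`, and `(0, 0, 0, 1)`
    -- outside the osculating plane.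
    refine hasCuspAt_of_directions h2 h3 hst
      (q := ![0, 0, s, 3 * t] - (h ⬝ᵥ ![0, 0, s, 3 * t] / h ⬝ᵥ cubicDt s t) • cubicDt s t)
      (r := ![0, 0, 0, 1] - (h ⬝ᵥ ![0, 0, 0, 1] / h ⬝ᵥ cubicDt s t) • cubicDt s t) hp ?_ ?_ ?_ ?_ ?_
    · rw [dotProduct_sub, dotProduct_smul, smul_eq_mul, div_mul_cancel₀ _ hd, sub_self]
    · rw [dotProduct_sub, dotProduct_smul, smul_eq_mul, div_mul_cancel₀ _ hd, sub_self]
    · simp [oscForm, cubicDt]; ring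
    · generalize h ⬝ᵥ ![0, 0, 0, 1] / h ⬝ᵥ cubicDt s t = c
      have : oscForm s t (![0, 0, 0, 1] - c • cubicDt s t) = s ^ 3 := by
        simp [oscForm, cubicDt]; ring
      rw [this]
      exact pow_ne_zero _ hs
    · generalize h ⬝ᵥ ![0, 0, s, 3 * t] / h ⬝ᵥ cubicDt s t = c
      convert! mul_ne_zero h2 (pow_ne_zero 6 hs) using 1
      simp [polarQuad, quad, cubicDt, cubicPt]; ring

/-- The cubic form cut out on the singular locus of the quartic by a general plane. -/
def planeCubic (k : Type*) [Field k] : Cubic (MvPolynomial (Fin 4) k) :=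
  ⟨C 4 * X 3, C 3 * X 0, C 3 * X 1, C 4 * X 2⟩

lemma planeCubic_discr_isHomogeneous : (planeCubic k).discr.IsHomogeneous 4 := by
  have hm := fun (a : k) (i : Fin 4) => isHomogeneous_C_mul_X a i
  -- Because of the offset by 2, the arguments `2`, `25`, `16` below stand for the constants `4`,
  -- `27`, `18`.
  have hC : ∀ n : ℕ, IsHomogeneous (OfNat.ofNat (n + 2) : MvPolynomial (Fin 4) k) 0 := by
    intro n
    rw [← map_ofNat (C : k →+* MvPolynomial (Fin 4) k) (n + 2)]
    exact isHomogeneous_C _ _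
  exact ((((((hm 3 0).pow 2).mul ((hm 3 1).pow 2)).sub
    (((hC 2).mul (hm 4 3)).mul ((hm 3 1).pow 3))).sub
    (((hC 2).mul ((hm 3 0).pow 3)).mul (hm 4 2))).sub
    (((hC 25).mul ((hm 4 3).pow 2)).mul ((hm 4 2).pow 2))).add
    (((((hC 16).mul (hm 4 3)).mul (hm 3 0)).mul (hm 3 1)).mul (hm 4 2))

/-- The singular locus of the quartic is a cuspidal curve. -/
lemma isCuspidalCurve_singularLocus [IsAlgClosed k] (h2 : (2 : k) ≠ 0) (h3 : (3 : k) ≠ 0) :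
    IsCuspidalCurve (quarticP k) (singularLocus (quarticP k)) := by
  have : Infinite k := IsAlgClosed.instInfinite
  have h4 := four_ne_zero_of_two_ne_zero h2
  have heval : ∀ h : Fin 4 → k, eval h (planeCubic k).discr =
      (⟨4 * h 3, 3 * h 0, 3 * h 1, 4 * h 2⟩ : Cubic k).discr := by
    intro h
    simp [planeCubic, Cubic.discr]
  -- A plane counts as general when it is nowhere tangent to the curve, that is, when the binary
  -- cubic it cuts out has nonzero discriminant.
  refine ⟨4, (planeCubic k).discr, planeCubic_discr_isHomogeneous, ?_, ?_⟩
  · intro H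
    -- This plane cuts out `4s³ + 3st²`, which has distinct roots.
    have := congrArg (eval ![0, 1, 0, 1]) H
    rw [heval] at this
    simp [Cubic.discr, h4, h3] at this
  · intro h _ hne x hx hhx
    rw [heval] at hne
    rw [singularLocus_quarticP h2 h3, mem_image_standardTwistedCubic] at hx
    obtain ⟨s, t, hst, e⟩ := hx
    rw [sectionHasCuspAt_iff, e, quarticP_eq_compLinear h2 h3]
    have hdot : ∀ v, h ⬝ᵥ singularCoords h2 h3 v =
        ![4 * h 3, 3 * h 0, 3 * h 1, 4 * h 2] ⬝ᵥ v := by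
      intro v
      simp [singularCoords, dotProduct, Fin.sum_univ_four]
      ring
    refine HasCuspAt.compLinear (h := ![4 * h 3, 3 * h 0, 3 * h 1, 4 * h 2]) ?_ fun v => by
      rw [← hdot, LinearEquiv.apply_symm_apply]
    rw [LinearEquiv.symm_apply_apply]
    rw [e, hdot] at hhx
    refine hasCuspAt_of_transversal h2 h3 hst hhx fun H => hne ?_
    refine (discr_eq_zero_iff_exists_double_root h2 h3 _).2 ⟨s, t, hst, ?_, ?_⟩
    · have := H.1
      simp [dotProduct, Fin.sum_univ_four, cubicDs] at this
      linear_combination this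
    · have := H.2
      simp [dotProduct, Fin.sum_univ_four, cubicDt] at this
      linear_combination this

end CuspsOfTheQuartic

/-! ### Quartics that are singular along the twisted cubic -/

section QuarticCoefficients

open Finset.Nat in
lemma sum_support_eq_sum_antidiagonalTuple {F : MvPolynomial (Fin 4) k} {d : ℕ}
    (hF : F.IsHomogeneous d) (f : (Fin 4 →₀ ℕ) → k) (hf : ∀ m, coeff m F = 0 → f m = 0) :
    ∑ m ∈ F.support, f m =
      ∑ v ∈ antidiagonalTuple 4 d, f (Finsupp.equivFunOnFinite.symm v) := by
  refine Eq.trans ?_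
    (Finset.sum_map (antidiagonalTuple 4 d) Finsupp.equivFunOnFinite.symm.toEmbedding f)
  refine Finset.sum_subset (fun m hm => ?_) fun m _ hm => hf m (by simpa using hm)
  rw [Finset.mem_map_equiv, mem_antidiagonalTuple, Equiv.symm_symm]
  have := hF (mem_support_iff.1 hm)
  rw [← this, Finsupp.weight_apply, Finsupp.sum_fintype _ _ (by simp)]
  simp

/-- On `(1, t, t², t³)` a monomial becomes a power of `t`, so a vanishing derivative gives one
linear equation on the coefficients for each weight `w`. -/
lemma coeff_sum_of_pderiv_eq_zero [Infinite k] {F : MvPolynomial (Fin 4) k} {i : Fin 4}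
    (h : ∀ t, eval (cubicPt 1 t) (pderiv i F) = 0) (w : ℕ) :
    ∑ m ∈ F.support, (if w = m 1 + 2 * m 2 + 3 * m 3 then (m i : k) * coeff m F else 0) = 0 := by
  -- Multiplying by `X i` makes the derivative diagonal on monomials, with eigenvalue the exponent
  -- of `X i`.
  have e1 : X i * pderiv i F = ∑ m ∈ F.support, monomial m ((m i : k) * coeff m F) := by
    conv_lhs => rw [F.as_sum]
    rw [map_sum, Finset.mul_sum]
    refine Finset.sum_congr rfl fun m _ => ?_
    rw [X_mul_pderiv_monomial, ← map_nsmul, nsmul_eq_mul]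
  have e2 : ∑ m ∈ F.support, Polynomial.C ((m i : k) * coeff m F) *
      Polynomial.X ^ (m 1 + 2 * m 2 + 3 * m 3) = 0 := by
    refine Polynomial.funext fun t => ?_
    have := congrArg (eval (cubicPt 1 t)) e1
    rw [map_mul, h, mul_zero, map_sum] at this
    rw [Polynomial.eval_zero, this, Polynomial.eval_finsetSum]
    refine Finset.sum_congr rfl fun m _ => ?_
    rw [eval_monomial, Finsupp.prod_fintype _ _ (by simp), Fin.prod_univ_four]
    simp [cubicPt, -mul_eq_mul_left_iff]
    ring
  have := congrArg (fun p => Polynomial.coeff p w) e2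
  simpa only [Polynomial.finsetSum_coeff, Polynomial.coeff_C_mul_X_pow, Polynomial.coeff_zero]
    using this

lemma sum_antidiagonalTuple_four (f : (Fin 4 → ℕ) → k) :
    ∑ v ∈ Finset.Nat.antidiagonalTuple 4 4, f v =
      f ![0, 0, 0, 4] + f ![0, 0, 1, 3] + f ![0, 0, 2, 2] + f ![0, 0, 3, 1] + f ![0, 0, 4, 0] +
      f ![0, 1, 0, 3] + f ![0, 1, 1, 2] + f ![0, 1, 2, 1] + f ![0, 1, 3, 0] + f ![0, 2, 0, 2] +
      f ![0, 2, 1, 1] + f ![0, 2, 2, 0] + f ![0, 3, 0, 1] + f ![0, 3, 1, 0] + f ![0, 4, 0, 0] +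
      f ![1, 0, 0, 3] + f ![1, 0, 1, 2] + f ![1, 0, 2, 1] + f ![1, 0, 3, 0] + f ![1, 1, 0, 2] +
      f ![1, 1, 1, 1] + f ![1, 1, 2, 0] + f ![1, 2, 0, 1] + f ![1, 2, 1, 0] + f ![1, 3, 0, 0] +
      f ![2, 0, 0, 2] + f ![2, 0, 1, 1] + f ![2, 0, 2, 0] + f ![2, 1, 0, 1] + f ![2, 1, 1, 0] +
      f ![2, 2, 0, 0] + f ![3, 0, 0, 1] + f ![3, 0, 1, 0] + f ![3, 1, 0, 0] + f ![4, 0, 0, 0] := by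
  have h : List.Nat.antidiagonalTuple 4 4 =
     [![0, 0, 0, 4], ![0, 0, 1, 3], ![0, 0, 2, 2], ![0, 0, 3, 1], ![0, 0, 4, 0], ![0, 1, 0, 3],
      ![0, 1, 1, 2], ![0, 1, 2, 1], ![0, 1, 3, 0], ![0, 2, 0, 2], ![0, 2, 1, 1], ![0, 2, 2, 0],
      ![0, 3, 0, 1], ![0, 3, 1, 0], ![0, 4, 0, 0], ![1, 0, 0, 3], ![1, 0, 1, 2], ![1, 0, 2, 1],
      ![1, 0, 3, 0], ![1, 1, 0, 2], ![1, 1, 1, 1], ![1, 1, 2, 0], ![1, 2, 0, 1], ![1, 2, 1, 0],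
      ![1, 3, 0, 0], ![2, 0, 0, 2], ![2, 0, 1, 1], ![2, 0, 2, 0], ![2, 1, 0, 1], ![2, 1, 1, 0],
      ![2, 2, 0, 0], ![3, 0, 0, 1], ![3, 0, 1, 0], ![3, 1, 0, 0], ![4, 0, 0, 0]] := by
    decide
  change ((List.Nat.antidiagonalTuple 4 4).map f).sum = _
  rw [h]
  simp only [List.map_cons, List.sum_cons, List.map_nil, List.sum_nil]
  ring

/-- The coefficients of a quartic form. -/
def quarticCoeff (F : MvPolynomial (Fin 4) k) (v : Fin 4 → ℕ) : k :=
  coeff (Finsupp.equivFunOnFinite.symm v) F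

lemma eval_eq_sum_quarticCoeff {F : MvPolynomial (Fin 4) k} (hF : F.IsHomogeneous 4)
    (x : Fin 4 → k) : eval x F = ∑ v ∈ Finset.Nat.antidiagonalTuple 4 4, quarticCoeff F v *
      (x 0 ^ v 0 * x 1 ^ v 1 * x 2 ^ v 2 * x 3 ^ v 3) := by
  rw [eval_eq', sum_support_eq_sum_antidiagonalTuple hF
    (fun m => coeff m F * ∏ i, x i ^ m i) (fun m hm => by simp [hm])]
  simp [quarticCoeff, Fin.prod_univ_four]

lemma sum_quarticCoeff_eq_zero [Infinite k] {F : MvPolynomial (Fin 4) k} (hF : F.IsHomogeneous 4)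
    {i : Fin 4} (h : ∀ t, eval (cubicPt 1 t) (pderiv i F) = 0) (w : ℕ) :
    ∑ v ∈ Finset.Nat.antidiagonalTuple 4 4,
      (if w = v 1 + 2 * v 2 + 3 * v 3 then (v i : k) * quarticCoeff F v else 0) = 0 := by
  have := coeff_sum_of_pderiv_eq_zero h w
  rw [sum_support_eq_sum_antidiagonalTuple hF
    (fun m => if w = m 1 + 2 * m 2 + 3 * m 3 then (m i : k) * coeff m F else 0)
    (fun m hm => by simp [hm])] at this
  exact this

/-- A quartic form whose gradient vanishes along the twisted cubic is a quadratic form in the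
three quadrics through the twisted cubic. -/
lemma exists_eq_quadQuartic [Infinite k] (h2 : (2 : k) ≠ 0) (h3 : (3 : k) ≠ 0)
    {F : MvPolynomial (Fin 4) k} (hF : F.IsHomogeneous 4)
    (h : ∀ i t, eval (cubicPt 1 t) (pderiv i F) = 0) :
    ∃ M : Matrix (Fin 3) (Fin 3) k, M.IsSymm ∧ F = quadQuartic M := by
  have E := fun i w => sum_quarticCoeff_eq_zero hF (h i) w
  have H := eval_eq_sum_quarticCoeff hF
  set f := quarticCoeff F with hf
  simp only [sum_antidiagonalTuple_four] at E H
  have h4 := four_ne_zero_of_two_ne_zero h2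
  have e0_0 := E 0 0
  have e1_1 := E 1 1
  have e2_2 := E 2 2
  have e1_2 := E 1 2
  have e3_3 := E 3 3
  have e2_3 := E 2 3
  have e0_3 := E 0 3
  have e3_4 := E 3 4
  have e0_4 := E 0 4
  have e1_4 := E 1 4
  have e3_5 := E 3 5
  have e0_5 := E 0 5
  have e1_5 := E 1 5
  have e3_12 := E 3 12
  have e2_11 := E 2 11
  have e1_10 := E 1 10
  have e2_10 := E 2 10
  have e0_9 := E 0 9
  have e1_9 := E 1 9
  have e3_9 := E 3 9
  have e0_8 := E 0 8
  have e3_8 := E 3 8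
  have e2_8 := E 2 8
  have e0_7 := E 0 7
  have e3_7 := E 3 7
  have e2_7 := E 2 7
  have e0_6 := E 0 6
  have e1_6 := E 1 6
  have e2_6 := E 2 6
  have e3_6 := E 3 6
  simp [h2, h4] at e0_0 e1_1 e2_2 e1_2 e3_3 e2_3 e0_3 e3_4
  simp [h2, h4] at e0_4 e1_4 e3_5 e0_5 e1_5 e3_12 e2_11 e1_10 e2_10
  simp at e0_9 e1_9 e3_9 e0_8 e3_8 e2_8 e0_7 e3_7 e2_7
  simp at e0_6 e1_6 e2_6 e3_6
  -- The six entries of `M` are read off from monomials that each occur in a single product `Qᵢ Qⱼ`;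
  -- mixed products occur twice, whence the factor 2. The equations determine all other
  -- coefficients.
  obtain ⟨b, hb⟩ : ∃ b, f ![2, 0, 1, 1] = 2 * b := ⟨f ![2, 0, 1, 1] / 2, by field_simp⟩
  obtain ⟨e, he⟩ : ∃ e, f ![1, 1, 0, 2] = 2 * e := ⟨f ![1, 1, 0, 2] / 2, by field_simp⟩
  obtain ⟨d, hd⟩ : ∃ d, f ![1, 0, 3, 0] = -2 * d := ⟨f ![1, 0, 3, 0] / (-2), by field_simp⟩
  have c1300 : f ![1, 3, 0, 0] = 0 := by
    simpa [e3_3, e2_3] using e0_3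
  have c0031 : f ![0, 0, 3, 1] = 0 := by
    simpa [e0_9, e1_9] using e3_9
  have c1210 : f ![1, 2, 1, 0] = -2 * f ![2, 0, 2, 0] := by
    linear_combination e0_4 - 2 * e3_4
  have c0121 : f ![0, 1, 2, 1] = -2 * f ![0, 2, 0, 2] := by
    linear_combination e3_8 - 2 * e0_8
  have c0400 : f ![0, 4, 0, 0] = f ![2, 0, 2, 0] := by
    apply mul_left_cancel₀ h4
    linear_combination e1_4 - e3_4 - 2 * c1210
  have c0040 : f ![0, 0, 4, 0] = f ![0, 2, 0, 2] := by
    apply mul_left_cancel₀ h4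
    linear_combination e2_8 - e0_8 - 2 * c0121
  have c1201 : f ![1, 2, 0, 1] = -2 * b := by
    linear_combination e3_5 - hb
  have c1021 : f ![1, 0, 2, 1] = -2 * e := by
    linear_combination e0_7 - he
  have c1120 : f ![1, 1, 2, 0] = -2 * b := by
    linear_combination e0_5 - c1201 - 2 * hb
  have c0211 : f ![0, 2, 1, 1] = -2 * e := by
    linear_combination e3_7 - c1021 - 2 * he
  have c0310 : f ![0, 3, 1, 0] = 2 * b := by
    apply mul_left_cancel₀ h3
    linear_combination e1_5 - c1120 - 2 * c1201
  have c0130 : f ![0, 1, 3, 0] = 2 * e := by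
    apply mul_left_cancel₀ h3
    linear_combination e2_7 - c0211 - 2 * c1021
  have c1111 : f ![1, 1, 1, 1] = -2 * f ![2, 0, 0, 2] + 2 * d := by
    linear_combination e0_6 - hd
  have c0301 : f ![0, 3, 0, 1] = -2 * d := by
    linear_combination e3_6 - c1111
  have c0220 : f ![0, 2, 2, 0] = f ![2, 0, 0, 2] + 2 * d := by
    apply mul_left_cancel₀ h2
    linear_combination e1_6 - c1111 - 3 * c0301
  refine ⟨!![f ![2, 0, 2, 0], b, d; b, f ![2, 0, 0, 2], e; d, e, f ![0, 2, 0, 2]], ?_, ?_⟩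
  · ext i j
    fin_cases i <;> fin_cases j <;> rfl
  · refine MvPolynomial.funext fun x => ?_
    rw [H, eval_quadQuartic]
    simp [quad, Fin.sum_univ_three]
    simp only [e0_0, e1_1, e2_2, e1_2, e3_3, e2_3, e3_4, e3_12, e2_11, e1_10, e2_10, e0_9, e1_9,
      e0_8, c1300, c0031, c1210, c0121, c0400, c0040, c1201, c1021, c1120, c0211, c0310, c0130,
      c1111, c0301, c0220, hb, he, hd]
    ring

end QuarticCoefficients

/-! ### The gradient at a cusp of a plane section -/

section Gradient

lemma IsOrdinaryCuspAtOrigin.eval_eq_zero {f : MvPolynomial (Fin 2) k}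
    (h : IsOrdinaryCuspAtOrigin f) : eval 0 f = 0 := by
  have := h.1
  rw [homogeneousComponent_zero, C_eq_zero, ← constantCoeff_eq] at this
  rwa [MvPolynomial.eval_zero]

lemma IsOrdinaryCuspAtOrigin.eval_pderiv_zero {f : MvPolynomial (Fin 2) k}
    (h : IsOrdinaryCuspAtOrigin f) (i : Fin 2) : eval 0 (pderiv i f) = 0 := by
  have := congrArg (coeff (Finsupp.single i 1)) h.2.1
  rw [coeff_homogeneousComponent, if_pos (by simp), coeff_zero] at this
  rw [MvPolynomial.eval_zero, constantCoeff_eq, coeff_pderiv, zero_add, this, zero_mul]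

lemma eval_pderiv_planeChart (F : MvPolynomial (Fin 4) k) (p q r : Fin 4 → k) :
    eval 0 (pderiv 0 (planeChart F p q r)) = dirDeriv F p q ∧
      eval 0 (pderiv 1 (planeChart F p q r)) = dirDeriv F p r := by
  have h : ∀ G, eval 0 (aeval (fun i => C (p i) + C (q i) * X 0 + C (r i) * X 1 :
      Fin 4 → MvPolynomial (Fin 2) k) G) = eval p G := by
    intro G
    have := eval_planeChart G p q r 0
    simpa [planeChart] using this
  constructor <;> rw [planeChart, derivation_aeval, map_sum, dirDeriv] <;>
    refine Finset.sum_congr rfl fun i _ => ?_ <;> rw [map_mul, h] <;>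
    simp [pderiv_X, mul_comm]

/-- The form vanishes on the whole line `x ↦ x p`, whose tangent at `x = 1` is `p`. -/
lemma dirDeriv_self [Infinite k] {F : MvPolynomial (Fin 4) k} {d : ℕ} (hF : F.IsHomogeneous d)
    {p : Fin 4 → k} (hp : eval p F = 0) : dirDeriv F p p = 0 := by
  have := dirDeriv_eq_zero_of_curve (F := F) (fun i => Polynomial.C (p i) * Polynomial.X)
    (fun x => by
      have : (fun i => (Polynomial.C (p i) * Polynomial.X).eval x) = x • p := by
        ext i
        rw [Polynomial.eval_mul, Polynomial.eval_C, Polynomial.eval_X, Pi.smul_apply, smul_eq_mul,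
          mul_comm]
      rw [this, hF.eval_smul, hp, mul_zero]) 1
  have a1 : (fun i => (Polynomial.C (p i) * Polynomial.X).eval 1) = p := by
    ext i
    simp
  have a2 : (fun i => (Polynomial.derivative (Polynomial.C (p i) * Polynomial.X)).eval 1) = p := by
    ext i
    simp
  rwa [a1, a2] at this

/-- At a cusp of a plane section, the gradient is proportional to the equation of the plane. -/
lemma HasCuspAt.dirDeriv_eq_zero [Infinite k] {F : MvPolynomial (Fin 4) k} {d : ℕ}
    (hF : F.IsHomogeneous d) {h p : Fin 4 → k} (hh : h ≠ 0) (hc : HasCuspAt F h p)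
    {v : Fin 4 → k} (hv : h ⬝ᵥ v = 0) : dirDeriv F p v = 0 := by
  obtain ⟨q, r, hli, hp, hq, hr, hcusp⟩ := hc
  have ep : eval p F = 0 := by
    have := hcusp.eval_eq_zero
    rw [eval_planeChart] at this
    simpa using this
  have eq := (eval_pderiv_planeChart F p q r).1.symm.trans (hcusp.eval_pderiv_zero 0)
  have er := (eval_pderiv_planeChart F p q r).2.symm.trans (hcusp.eval_pderiv_zero 1)
  let φ : (Fin 4 → k) →ₗ[k] k := dotProductBilin k k h
  have hφ : ∀ w, φ w = h ⬝ᵥ w := fun w => rfl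
  have hφ0 : φ ≠ 0 := by
    intro H
    apply hh
    ext i
    have := LinearMap.congr_fun H (Pi.single i 1)
    simpa [hφ] using this
  have hle : Submodule.span k (Set.range ![p, q, r]) ≤ LinearMap.ker φ := by
    rw [Submodule.span_le]
    rintro _ ⟨i, rfl⟩
    fin_cases i
    exacts [hp, hq, hr]
  -- By dimension the chart vectors span the plane, and the derivative vanishes on each of them.
  have hspan : Submodule.span k (Set.range ![p, q, r]) = LinearMap.ker φ := by
    apply Submodule.eq_of_le_of_finrank_eq hle
    rw [finrank_span_eq_card hli]
    have := Module.Dual.finrank_ker_add_one_of_ne_zero (f := φ) hφ0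
    simp at this
    simp
    omega
  have hv' : v ∈ Submodule.span k (Set.range ![p, q, r]) := by
    rw [hspan]
    exact hv
  obtain ⟨c, rfl⟩ := (Submodule.mem_span_range_iff_exists_fun k).1 hv'
  rw [Fin.sum_univ_three]
  simp [dirDeriv_add, dirDeriv_smul, dirDeriv_self hF ep, eq, er]

end Gradient

/-! ### General planes through general points of the twisted cubic -/

section Density

/-- A polynomial that vanishes wherever a given nonzero polynomial does not is zero. -/
lemma eq_zero_of_generic [Infinite k] {σ : Type*} {Θ G : MvPolynomial σ k} (hΘ : Θ ≠ 0)
    (h : ∀ x, eval x Θ ≠ 0 → eval x G = 0) : G = 0 := by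
  have : Θ * G = 0 := MvPolynomial.funext fun x => by
    rw [map_mul, map_zero, mul_eq_zero]
    by_cases hx : eval x Θ = 0
    · exact Or.inl hx
    · exact Or.inr (h x hx)
  exact (mul_eq_zero.1 this).resolve_left hΘ

/-- The planes through the point `(1 : t : t² : t³)` of the twisted cubic, as a function of `t` and
three further parameters. -/
def planePencil {A : Type*} [CommRing A] (x : Fin 4 → A) : Fin 4 → A :=
  ![x 0 * x 1, x 0 * x 2 - x 1, x 0 * x 3 - x 2, -x 3]

/-- As polynomials in `T`, the planes of the pencil are `(x₀ - T)(x₁ + x₂ T + x₃ T²)`. A plane thus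
lies in it through any root of its cubic, and the quotient comes from Horner's scheme. -/
lemma exists_planePencil_eq [IsAlgClosed k] {h : Fin 4 → k} (h3 : h 3 ≠ 0) :
    ∃ x : Fin 4 → k, planePencil x = h := by
  let P : Cubic k := ⟨h 3, h 2, h 1, h 0⟩
  obtain ⟨τ, hτ⟩ := IsAlgClosed.exists_root P.toPoly (by
    rw [Cubic.degree_of_a_ne_zero (P := P) h3]
    norm_num)
  have hτ' : h 3 * τ ^ 3 + h 2 * τ ^ 2 + h 1 * τ + h 0 = 0 := by
    simpa [Polynomial.IsRoot, Cubic.toPoly, P] using hτ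
  refine ⟨![τ, τ * (τ * (-h 3) - h 2) - h 1, τ * (-h 3) - h 2, -h 3], ?_⟩
  ext i
  fin_cases i <;> simp [planePencil]
  linear_combination -hτ'

lemma planePencil_dotProduct (x : Fin 4 → k) : planePencil x ⬝ᵥ cubicPt 1 (x 0) = 0 := by
  simp [planePencil, cubicPt, dotProduct, Fin.sum_univ_four]
  ring

/-- The parameters of the planes that are transversal to the twisted cubic at the point. -/
def transversality {A : Type*} [CommRing A] (x : Fin 4 → A) : A :=
  x 1 + x 0 * x 2 + x 0 ^ 2 * x 3

lemma planePencil_dotProduct_cubicDt (x : Fin 4 → k) :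
    planePencil x ⬝ᵥ cubicDt 1 (x 0) = -transversality x := by
  simp [planePencil, cubicDt, dotProduct, Fin.sum_univ_four, transversality]
  ring

/-- The parametrized pairs of a point and a plane through it reach every plane with `h 3 ≠ 0`, so a
nonzero condition on planes pulls back to a nonzero condition on parameters. -/
lemma exists_generic_parameters [IsAlgClosed k] {Ψ : MvPolynomial (Fin 4) k} (hΨ : Ψ ≠ 0) :
    ∃ Θ : MvPolynomial (Fin 4) k, Θ ≠ 0 ∧ ∀ x, eval x Θ ≠ 0 →
      eval (planePencil x) Ψ ≠ 0 ∧ transversality x ≠ 0 := by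
  have : Infinite k := IsAlgClosed.instInfinite
  have e1 : ∀ x : Fin 4 → k, eval x (aeval (planePencil X) Ψ) = eval (planePencil x) Ψ := by
    intro x
    have : aeval x (aeval (planePencil (X : Fin 4 → MvPolynomial (Fin 4) k)) Ψ) =
        aeval (planePencil x) Ψ := by
      rw [← AlgHom.comp_apply]
      congr 1
      ext i
      fin_cases i <;> simp [planePencil]
    exact this
  have e2 : ∀ x : Fin 4 → k, eval x (transversality X) = transversality x := by
    intro x
    simp [transversality]
  refine ⟨aeval (planePencil X) Ψ * transversality X, mul_ne_zero ?_ ?_, fun x hx => ?_⟩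
  · intro H
    refine mul_ne_zero hΨ (X_ne_zero 3) (MvPolynomial.funext fun h => ?_)
    rw [map_mul, eval_X, map_zero, mul_eq_zero]
    by_cases h3 : h 3 = 0
    · exact Or.inr h3
    · obtain ⟨x, rfl⟩ := exists_planePencil_eq h3
      rw [← e1, H, map_zero]
      exact Or.inl rfl
  · intro H
    have := congrArg (eval ![0, 1, 0, 0]) H
    rw [e2] at this
    simp [transversality] at this
  · rw [map_mul, e1, e2] at hx
    exact ⟨left_ne_zero_of_mul hx, right_ne_zero_of_mul hx⟩

/-- The linear change of dual coordinates induced by a linear change of coordinates. -/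
def dualChange (g : (Fin 4 → k) ≃ₗ[k] (Fin 4 → k)) : (Fin 4 → k) →ₗ[k] (Fin 4 → k) where
  toFun h := fun i => h ⬝ᵥ g (Pi.single i 1)
  map_add' h h' := by
    ext i
    simp [add_dotProduct]
  map_smul' c h := by
    ext i
    simp [smul_dotProduct]

lemma dualChange_dotProduct (g : (Fin 4 → k) ≃ₗ[k] (Fin 4 → k)) (h v : Fin 4 → k) :
    dualChange g h ⬝ᵥ v = h ⬝ᵥ g v := by
  simp only [dotProduct, dualChange, LinearMap.coe_mk, AddHom.coe_mk,
    linearEquiv_apply_eq_sum g v, Finset.sum_mul, Finset.mul_sum]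
  rw [Finset.sum_comm]
  exact Finset.sum_congr rfl fun i _ => Finset.sum_congr rfl fun j _ => by ring

lemma dualChange_symm_dualChange (g : (Fin 4 → k) ≃ₗ[k] (Fin 4 → k)) (h : Fin 4 → k) :
    dualChange g.symm (dualChange g h) = h := by
  ext i
  have := (dualChange_dotProduct g.symm (dualChange g h) (Pi.single i 1)).trans
    (dualChange_dotProduct g h (g.symm (Pi.single i 1)))
  rw [g.apply_symm_apply] at this
  simpa using this

/-- The linear change of dual coordinates, as an isomorphism. -/
def dualEquiv (g : (Fin 4 → k) ≃ₗ[k] (Fin 4 → k)) : (Fin 4 → k) ≃ₗ[k] (Fin 4 → k) :=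
  LinearEquiv.ofLinearMap (dualChange g) (dualChange g.symm)
    (LinearMap.ext fun h => dualChange_symm_dualChange g.symm h)
    (LinearMap.ext fun h => dualChange_symm_dualChange g h)

/-- In suitable coordinates, the section of a surface with a cuspidal twisted cubic by a general
plane through a general point of the cubic has a cusp there. -/
lemma IsCuspidalCurve.exists_generic [IsAlgClosed k] {F : MvPolynomial (Fin 4) k} {d : ℕ}
    (hF : F.IsHomogeneous d) {g : (Fin 4 → k) ≃ₗ[k] (Fin 4 → k)}
    (h : IsCuspidalCurve F
      (Projectivization.map g.toLinearMap g.injective '' standardTwistedCubic k)) :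
    ∃ Θ : MvPolynomial (Fin 4) k, Θ ≠ 0 ∧ ∀ x, eval x Θ ≠ 0 →
      HasCuspAt (compLinear F g) (planePencil x) (cubicPt 1 (x 0)) ∧ transversality x ≠ 0 := by
  have : Infinite k := IsAlgClosed.instInfinite
  obtain ⟨n, Φ, -, hΦ, hcusp⟩ := h
  -- The genericity condition is transported to dual coordinates adapted to `g`; an invertible
  -- change keeps it nonzero.
  have hΨ : compLinear Φ (dualEquiv g.symm) ≠ 0 := by
    intro H
    refine hΦ (MvPolynomial.funext fun x => ?_)
    have := eval_compLinear Φ (dualEquiv g.symm) ((dualEquiv g.symm).symm x)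
    rw [LinearEquiv.apply_symm_apply, H] at this
    rw [← this, map_zero, map_zero]
  obtain ⟨Θ, hΘ, hΘ'⟩ := exists_generic_parameters hΨ
  refine ⟨Θ, hΘ, fun x hx => ⟨?_, (hΘ' x hx).2⟩⟩
  obtain ⟨h1, h2⟩ := hΘ' x hx
  rw [eval_compLinear] at h1
  have hp0 : planePencil x ≠ 0 := by
    intro H
    have := planePencil_dotProduct_cubicDt x
    rw [H, zero_dotProduct] at this
    exact h2 (neg_eq_zero.1 this.symm)
  obtain ⟨y, hy, r, hr, e⟩ := exists_rep_eq_cubicPt g (s := (1 : k)) (t := x 0) (by simp)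
  rw [← smul_cubicPt, map_smul] at e
  have hdot : ∀ v, dualEquiv g.symm (planePencil x) ⬝ᵥ v = planePencil x ⬝ᵥ g.symm v :=
    dualChange_dotProduct g.symm _
  have := hcusp (dualEquiv g.symm (planePencil x)) (by simpa using hp0) h1 y hy (by
    rw [e, hdot, map_smul, g.symm_apply_apply, dotProduct_smul, planePencil_dotProduct, smul_zero])
  rw [sectionHasCuspAt_iff, e] at this
  refine (this.of_smul hF (pow_ne_zero 3 hr)).compLinear fun v => ?_
  rw [hdot, g.symm_apply_apply]

/-- A quartic surface with a cuspidal twisted cubic is singular along the cubic. -/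
lemma exists_quadQuartic_of_generic_cusps [IsAlgClosed k] (h2 : (2 : k) ≠ 0) (h3 : (3 : k) ≠ 0)
    {F Θ : MvPolynomial (Fin 4) k} (hF : F.IsHomogeneous 4) (hΘ : Θ ≠ 0)
    (h : ∀ x, eval x Θ ≠ 0 →
      HasCuspAt F (planePencil x) (cubicPt 1 (x 0)) ∧ transversality x ≠ 0) :
    ∃ M : Matrix (Fin 3) (Fin 3) k, M.IsSymm ∧ F = quadQuartic M := by
  have : Infinite k := IsAlgClosed.instInfinite
  apply exists_eq_quadQuartic h2 h3 hF
  -- At a cusp the gradient is proportional to the plane. These minors vanish generically, hence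
  -- identically, and so also for special planes.
  have minor : ∀ (i j : Fin 4) (x : Fin 4 → k),
      planePencil x i * eval (cubicPt 1 (x 0)) (pderiv j F) =
      planePencil x j * eval (cubicPt 1 (x 0)) (pderiv i F) := by
    intro i j x
    have e1 : ∀ (x : Fin 4 → k) G, eval x (aeval (cubicPt 1 (X 0)) G : MvPolynomial (Fin 4) k) =
        eval (cubicPt 1 (x 0)) G := by
      intro x G
      have : aeval x (aeval (cubicPt 1 (X 0 : MvPolynomial (Fin 4) k)) G) =
          aeval (cubicPt 1 (x 0)) G := by
        rw [← AlgHom.comp_apply]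
        congr 1
        ext i
        fin_cases i <;> simp [cubicPt]
      exact this
    have e2 : ∀ (x : Fin 4 → k) i, eval x (planePencil X i) = planePencil x i := by
      intro x i
      fin_cases i <;> simp [planePencil]
    have := eq_zero_of_generic (G := planePencil X i * aeval (cubicPt 1 (X 0)) (pderiv j F) -
      planePencil X j * aeval (cubicPt 1 (X 0)) (pderiv i F)) hΘ (fun x hx => by
        obtain ⟨hc, ht⟩ := h x hx
        have hp0 : planePencil x ≠ 0 := by
          intro H
          have := planePencil_dotProduct_cubicDt x
          rw [H, zero_dotProduct] at this
          exact ht (neg_eq_zero.1 this.symm)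
        have := hc.dirDeriv_eq_zero hF hp0
          (v := planePencil x i • Pi.single j 1 - planePencil x j • Pi.single i 1)
          (by simp [dotProduct_sub, dotProduct_smul, mul_comm])
        simp only [map_sub, map_mul, e1, e2]
        simpa [dirDeriv, sub_mul, Finset.sum_sub_distrib, Pi.single_apply] using this)
    have := congrArg (eval x) this
    simp only [map_sub, map_mul, e1, e2, map_zero] at this
    exact sub_eq_zero.1 this
  intro i t
  -- The planes `(0, 0, t, -1)` and `(-t, 1, 0, 0)` pass through the same point; the first kills the
  -- partial derivatives 0 and 1, the second 2 and 3.
  fin_cases i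
  · have := minor 3 0 ![t, 0, 0, 1]
    simpa [planePencil] using this
  · have := minor 3 1 ![t, 0, 0, 1]
    simpa [planePencil] using this
  · have := minor 1 2 ![t, -1, 0, 0]
    simpa [planePencil] using this
  · have := minor 1 3 ![t, -1, 0, 0]
    simpa [planePencil] using this

end Density

/-! ### Projective uniqueness -/

section Uniqueness

/-- The Gram determinant of the bilinear form `M` on the plane of those `v` that satisfy
`v₂ = t v₁ - t² v₀`, in the basis given by the first two coordinates. -/
def gramDet (M : Matrix (Fin 3) (Fin 3) k) (t : k) : k :=
  (M 0 0 - 2 * t ^ 2 * M 0 2 + t ^ 4 * M 2 2) * (M 1 1 + 2 * t * M 1 2 + t ^ 2 * M 2 2) -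
    (M 0 1 + t * M 0 2 - t ^ 2 * M 1 2 - t ^ 3 * M 2 2) ^ 2

/-- The differentials of the quadrics are dependent at a point of the curve; the planes so obtained
are, as `t` varies, tangent planes of the cone `v₁² = 4 v₀ v₂`. -/
lemma polarQuad_cubicPt_two (t : k) (w : Fin 4 → k) :
    polarQuad (cubicPt 1 t) w 2 =
      t * polarQuad (cubicPt 1 t) w 1 - t ^ 2 * polarQuad (cubicPt 1 t) w 0 := by
  simp [polarQuad, cubicPt]
  ring

/-- A multiple of a square has zero Gram determinant, and a change of basis multiplies the Gram
determinant by the square of its determinant. -/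
lemma gramDet_mul_sq_eq_zero (h2 : (2 : k) ≠ 0) {M : Matrix (Fin 3) (Fin 3) k} (hM : M.IsSymm)
    {t : k} {q r : Fin 4 → k} {l : MvPolynomial (Fin 2) k} {c : k} (hl : l.IsHomogeneous 1)
    (h : chartQuadratic M (cubicPt 1 t) q r = C c * l ^ 2) :
    (polarQuad (cubicPt 1 t) q 0 * polarQuad (cubicPt 1 t) r 1 -
      polarQuad (cubicPt 1 t) q 1 * polarQuad (cubicPt 1 t) r 0) ^ 2 * gramDet M t = 0 := by
  obtain ⟨m, n, rfl⟩ := exists_linear_eq hl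
  have hq := polarQuad_cubicPt_two t q
  have hr := polarQuad_cubicPt_two t r
  -- Values at three points recover the Gram entries by polarization, which needs `2 ≠ 0`.
  have e1 := congrArg (eval ![1, 0]) h
  have e2 := congrArg (eval ![0, 1]) h
  have e3 := congrArg (eval ![1, 1]) h
  simp only [chartQuadratic, chartLinear, Fin.sum_univ_three, map_add, map_mul, map_pow, eval_C,
    eval_X, Matrix.cons_val_zero, Matrix.cons_val_one, mul_one, mul_zero, add_zero, zero_add,
    hq, hr, hM.apply 0 1, hM.apply 0 2, hM.apply 1 2] at e1 e2 e3
  rw [gramDet]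
  generalize polarQuad (cubicPt 1 t) q 0 = a0 at *
  generalize polarQuad (cubicPt 1 t) q 1 = a1 at *
  generalize polarQuad (cubicPt 1 t) r 0 = b0 at *
  generalize polarQuad (cubicPt 1 t) r 1 = b1 at *
  set Maa := a0 ^ 2 * M 0 0 + a1 ^ 2 * M 1 1 + (t * a1 - t ^ 2 * a0) ^ 2 * M 2 2 +
    2 * a0 * a1 * M 0 1 + 2 * a0 * (t * a1 - t ^ 2 * a0) * M 0 2 +
    2 * a1 * (t * a1 - t ^ 2 * a0) * M 1 2 with hMaa
  set Mbb := b0 ^ 2 * M 0 0 + b1 ^ 2 * M 1 1 + (t * b1 - t ^ 2 * b0) ^ 2 * M 2 2 +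
    2 * b0 * b1 * M 0 1 + 2 * b0 * (t * b1 - t ^ 2 * b0) * M 0 2 +
    2 * b1 * (t * b1 - t ^ 2 * b0) * M 1 2 with hMbb
  set Mab := a0 * b0 * M 0 0 + a1 * b1 * M 1 1 +
    (t * a1 - t ^ 2 * a0) * (t * b1 - t ^ 2 * b0) * M 2 2 +
    (a0 * b1 + a1 * b0) * M 0 1 +
    (a0 * (t * b1 - t ^ 2 * b0) + b0 * (t * a1 - t ^ 2 * a0)) * M 0 2 +
    (a1 * (t * b1 - t ^ 2 * b0) + b1 * (t * a1 - t ^ 2 * a0)) * M 1 2 with hMab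
  have f1 : Maa = c * m ^ 2 := by rw [hMaa]; linear_combination e1
  have f2 : Mbb = c * n ^ 2 := by rw [hMbb]; linear_combination e2
  have f3 : Mab = c * m * n := by
    apply mul_left_cancel₀ h2
    rw [hMab]
    linear_combination e3 - e1 - e2
  have : Maa * Mbb - Mab ^ 2 = 0 := by
    rw [f1, f2, f3]
    ring
  rw [← this, hMaa, hMbb, hMab]
  ring

lemma polarQuad_add_smul (p q r : Fin 4 → k) (a b : k) (i : Fin 3) :
    polarQuad p (a • q + b • r) i = a * polarQuad p q i + b * polarQuad p r i := by
  fin_cases i <;> simp [polarQuad] <;> ring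

/-- The differentials of the quadrics have rank two on a plane that is transversal to the
twisted cubic. -/
lemma polarQuad_minor_ne_zero (h3 : (3 : k) ≠ 0) {t : k} {h q r : Fin 4 → k}
    (hli : LinearIndependent k ![cubicPt 1 t, q, r]) (hp : h ⬝ᵥ cubicPt 1 t = 0)
    (hq : h ⬝ᵥ q = 0) (hr : h ⬝ᵥ r = 0) (ht : h ⬝ᵥ cubicDt 1 t ≠ 0) :
    polarQuad (cubicPt 1 t) q 0 * polarQuad (cubicPt 1 t) r 1 -
      polarQuad (cubicPt 1 t) q 1 * polarQuad (cubicPt 1 t) r 0 ≠ 0 := by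
  intro H
  -- The common kernel of the differentials consists of tangent vectors. A plane transversal to the
  -- curve contains only the multiples of `cubicPt 1 t` among them, and these are independent of `q`
  -- and `r`.
  have key : ∀ a b : k, (a * polarQuad (cubicPt 1 t) q 0 + b * polarQuad (cubicPt 1 t) r 0 = 0) →
      (a * polarQuad (cubicPt 1 t) q 1 + b * polarQuad (cubicPt 1 t) r 1 = 0) →
      a = 0 ∧ b = 0 := by
    intro a b h0 h1
    obtain ⟨P, Q, e⟩ := (polarQuad_eq_zero_iff h3 (s := 1) (t := t) (by simp) (a • q + b • r)).1
      (fun i => by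
        rw [polarQuad_add_smul]
        fin_cases i
        · exact h0
        · exact h1
        · change _ * polarQuad (cubicPt 1 t) q 2 + _ * polarQuad (cubicPt 1 t) r 2 = 0
          rw [polarQuad_cubicPt_two, polarQuad_cubicPt_two]
          linear_combination t * h1 - t ^ 2 * h0)
    have htan := congrArg (h ⬝ᵥ ·) (cubicPt_eq_tangent 1 t)
    have e' := congrArg (h ⬝ᵥ ·) e
    simp only [dotProduct_add, dotProduct_smul, hp, hq, hr, smul_eq_mul] at htan e'
    have hQ : Q = P * t := by
      apply mul_right_cancel₀ ht
      linear_combination -e' - P * htan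
    have hz : a • q + b • r = (3 * P) • cubicPt 1 t := by
      rw [e, hQ, mul_comm 3 P, mul_smul P 3, ← cubicPt_eq_tangent, one_smul, smul_add, smul_smul]
    rw [Fintype.linearIndependent_iff] at hli
    have := hli ![-(3 * P), a, b] (by
      rw [Fin.sum_univ_three]
      simp only [Matrix.cons_val]
      rw [add_assoc, hz, neg_smul, neg_add_cancel])
    exact ⟨this 1, this 2⟩
  -- The vanishing minor makes two combinations admissible for `key`, which forces all four entries
  -- to be zero; then `key 1 0` is absurd.
  have h0 := key (polarQuad (cubicPt 1 t) r 0) (-polarQuad (cubicPt 1 t) q 0) (by ring)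
    (by linear_combination -H)
  have h1 := key (polarQuad (cubicPt 1 t) r 1) (-polarQuad (cubicPt 1 t) q 1)
    (by linear_combination H) (by ring)
  have := key 1 0 (by simpa using h0.2) (by simpa using h1.2)
  simp at this

lemma HasCuspAt.gramDet_eq_zero (h2 : (2 : k) ≠ 0) (h3 : (3 : k) ≠ 0)
    {M : Matrix (Fin 3) (Fin 3) k} (hM : M.IsSymm) {x : Fin 4 → k}
    (hc : HasCuspAt (quadQuartic M) (planePencil x) (cubicPt 1 (x 0)))
    (hx : transversality x ≠ 0) : gramDet M (x 0) = 0 := by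
  obtain ⟨q, r, hli, hp, hq, hr, hcusp⟩ := hc
  obtain ⟨l, hl, -, ⟨c, -, h⟩, -⟩ :=
    (isOrdinaryCuspAtOrigin_quadQuartic_iff M (quad_cubicPt 1 (x 0)) q r).1 hcusp
  refine (mul_eq_zero.1 (gramDet_mul_sq_eq_zero h2 hM hl h)).resolve_left (pow_ne_zero 2 ?_)
  refine polarQuad_minor_ne_zero h3 hli hp hq hr ?_
  rwa [planePencil_dotProduct_cubicDt, neg_ne_zero]

lemma gramDet_eq_zero_of_generic [Infinite k] {M : Matrix (Fin 3) (Fin 3) k}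
    {Θ : MvPolynomial (Fin 4) k} (hΘ : Θ ≠ 0) (h : ∀ x, eval x Θ ≠ 0 → gramDet M (x 0) = 0)
    (t : k) : gramDet M t = 0 := by
  let G : MvPolynomial (Fin 4) k :=
    (C (M 0 0) - 2 * X 0 ^ 2 * C (M 0 2) + X 0 ^ 4 * C (M 2 2)) *
      (C (M 1 1) + 2 * X 0 * C (M 1 2) + X 0 ^ 2 * C (M 2 2)) -
      (C (M 0 1) + X 0 * C (M 0 2) - X 0 ^ 2 * C (M 1 2) - X 0 ^ 3 * C (M 2 2)) ^ 2
  have hG : ∀ x, eval x G = gramDet M (x 0) := fun x => by simp [G, gramDet]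
  have := eq_zero_of_generic (G := G) hΘ fun x hx => (hG x).trans (h x hx)
  simpa [this] using (hG ![t, 0, 0, 0]).symm

/-- For symmetric `M`, `gramDet M t` is the adjugate form at the plane `(t², -t, 1)`. Its five
coefficients in `t` leave one free minor, so the adjugate is a multiple of the dual of `v₁² = 4 v₀
v₂`. -/
lemma minors_of_gramDet_eq_zero [Infinite k] (h2 : (2 : k) ≠ 0) {M : Matrix (Fin 3) (Fin 3) k}
    (h : ∀ t, gramDet M t = 0) :
    M 0 0 * M 1 1 = M 0 1 ^ 2 ∧ M 0 0 * M 1 2 = M 0 1 * M 0 2 ∧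
      M 0 0 * M 2 2 - M 0 2 ^ 2 = 2 * (M 0 2 * M 1 1 - M 0 1 * M 1 2) ∧
      M 0 1 * M 2 2 = M 0 2 * M 1 2 ∧ M 1 1 * M 2 2 = M 1 2 ^ 2 := by
  let G : Polynomial k := Polynomial.C (M 0 0 * M 1 1 - M 0 1 ^ 2) +
    Polynomial.C (2 * (M 0 0 * M 1 2 - M 0 1 * M 0 2)) * Polynomial.X ^ 1 +
    Polynomial.C (M 0 0 * M 2 2 - M 0 2 ^ 2 - 2 * (M 0 2 * M 1 1 - M 0 1 * M 1 2)) *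
      Polynomial.X ^ 2 +
    Polynomial.C (2 * (M 0 1 * M 2 2 - M 0 2 * M 1 2)) * Polynomial.X ^ 3 +
    Polynomial.C (M 1 1 * M 2 2 - M 1 2 ^ 2) * Polynomial.X ^ 4
  have hG : G = 0 := Polynomial.funext fun t => by
    rw [Polynomial.eval_zero, ← h t, gramDet]
    simp only [G, Polynomial.eval_add, Polynomial.eval_mul, Polynomial.eval_C, Polynomial.eval_pow,
      Polynomial.eval_X]
    ring
  have hc : ∀ n, G.coeff n = 0 := fun n => by rw [hG, Polynomial.coeff_zero]
  have c0 := hc 0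
  have c1 := hc 1
  have c2 := hc 2
  have c3 := hc 3
  have c4 := hc 4
  simp only [G, Polynomial.coeff_add, Polynomial.coeff_C_mul, Polynomial.coeff_X_pow,
    Polynomial.coeff_C] at c0 c1 c2 c3 c4
  norm_num [h2] at c0 c1 c2 c3 c4
  exact ⟨sub_eq_zero.1 c0, sub_eq_zero.1 c1, sub_eq_zero.1 c2, sub_eq_zero.1 c3, sub_eq_zero.1 c4⟩

/-- A quadratic form in the quadrics whose Gram determinants vanish is either a multiple of the
discriminant or a multiple of a square. -/
lemma eq_discriminant_or_rank_one [Infinite k] (h2 : (2 : k) ≠ 0) {M : Matrix (Fin 3) (Fin 3) k}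
    (hM : M.IsSymm) (h : ∀ t, gramDet M t = 0) :
    (∃ c, c ≠ 0 ∧ ∀ x, eval x (quadQuartic M) = c * cubicDisc x) ∨
      ∃ (c : k) (v : Fin 3 → k), ∀ i j, M i j = c * (v i * v j) := by
  obtain ⟨e0, e1, e2, e3, e4⟩ := minors_of_gramDet_eq_zero h2 h
  have s1 := hM.apply 0 1
  have s2 := hM.apply 0 2
  have s3 := hM.apply 1 2
  -- If the remaining free minor vanishes, all 2 × 2 minors do: `M` has rank at most one and is
  -- recovered from a column with nonzero diagonal entry, or is zero.
  by_cases hn : M 0 2 * M 1 1 - M 0 1 * M 1 2 = 0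
  · right
    rw [hn, mul_zero] at e2
    by_cases h00 : M 0 0 = 0
    · by_cases h11 : M 1 1 = 0
      · by_cases h22 : M 2 2 = 0
        · have z1 : M 0 1 = 0 := by simpa [h00] using e0.symm
          have z2 : M 0 2 = 0 := by simpa [h00] using e2
          have z3 : M 1 2 = 0 := by simpa [h11] using e4.symm
          refine ⟨0, 0, fun i j => ?_⟩
          fin_cases i <;> fin_cases j <;> simp [h00, h11, h22, z1, z2, z3, s1, s2, s3]
        · refine ⟨(M 2 2)⁻¹, fun i => M i 2, fun i j => ?_⟩
          rw [eq_inv_mul_iff_mul_eq₀ h22]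
          fin_cases i <;> fin_cases j <;> simp [s1, s2, s3]
          · linear_combination e2
          · linear_combination e3
          · ring
          · linear_combination e3
          · linear_combination e4
          · ring
      · refine ⟨(M 1 1)⁻¹, fun i => M i 1, fun i j => ?_⟩
        rw [eq_inv_mul_iff_mul_eq₀ h11]
        fin_cases i <;> fin_cases j <;> simp [s1, s2, s3] <;>
          first | ring1 | linear_combination e0 | linear_combination hn | linear_combination e4
    · refine ⟨(M 0 0)⁻¹, fun i => M i 0, fun i j => ?_⟩
      rw [eq_inv_mul_iff_mul_eq₀ h00]
      fin_cases i <;> fin_cases j <;> simp [s1, s2, s3]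
      · ring
      · linear_combination e0
      · linear_combination e1
      · ring
      · linear_combination e1
      · linear_combination e2
  · left
    set n := M 0 2 * M 1 1 - M 0 1 * M 1 2 with hn'
    -- With a nonzero minor, `M 0 0` and `M 2 2` are killed by it; then only `M 1 1` and `M 0 2 = -2
    -- M 1 1` survive.
    have z00 : M 0 0 = 0 := by
      refine (mul_eq_zero.1 ?_).resolve_right hn
      rw [hn']
      linear_combination M 0 2 * e0 - M 0 1 * e1
    have z22 : M 2 2 = 0 := by
      refine (mul_eq_zero.1 ?_).resolve_right hn
      rw [hn']
      linear_combination M 0 2 * e4 - M 1 2 * e3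
    have z01 : M 0 1 = 0 := by simpa [z00] using e0.symm
    have z12 : M 1 2 = 0 := by simpa [z22] using e4.symm
    have hn1 : n = M 0 2 * M 1 1 := by rw [hn', z01]; ring
    have z02 : M 0 2 ≠ 0 := fun H => hn (by rw [hn1, H, zero_mul])
    have z11 : M 1 1 ≠ 0 := fun H => hn (by rw [hn1, H, mul_zero])
    have w : M 0 2 = -2 * M 1 1 := by
      apply mul_left_cancel₀ z02
      rw [hn1, z00] at e2
      linear_combination -e2
    refine ⟨M 1 1, z11, fun x => ?_⟩
    rw [eval_quadQuartic]
    simp [Fin.sum_univ_three, z00, z22, z01, z12, s1, s2, s3, w, cubicDisc]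
    ring

/-- A square of a quadric has no cuspidal plane sections along the twisted cubic. -/
lemma not_hasCuspAt_of_rank_one [IsAlgClosed k] {M : Matrix (Fin 3) (Fin 3) k} {κ : k}
    {v : Fin 3 → k} (hM : ∀ i j, M i j = κ * (v i * v j)) {h p : Fin 4 → k}
    (hp : ∀ i, quad p i = 0) : ¬ HasCuspAt (quadQuartic M) h p := by
  rintro ⟨q, r, -, -, -, -, hcusp⟩
  obtain ⟨l, hl, hl0, ⟨c, hc, hquad⟩, hdvd⟩ :=
    (isOrdinaryCuspAtOrigin_quadQuartic_iff M hp q r).1 hcusp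
  set lam : MvPolynomial (Fin 2) k := ∑ i, C (v i) * chartLinear p q r i with hlam
  have hlam1 : lam.IsHomogeneous 1 :=
    IsHomogeneous.sum _ _ _ fun i _ => (chartLinear_isHomogeneous p q r i).C_mul _
  have e1 : chartQuadratic M p q r = C κ * lam ^ 2 := by
    simp only [chartQuadratic, hM, hlam, Fin.sum_univ_three, map_mul]
    ring
  have e2 : chartCubic M p q r =
      lam * (C (2 * κ) * ∑ i, C (v i) * quad (chartVector q r) i) := by
    simp only [chartCubic, hM, hlam, Fin.sum_univ_three, map_mul, map_ofNat C 2]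
    ring
  -- Square roots of the constants turn the two expressions of the quadratic part into equal
  -- squares. So `l` divides `lam`, which divides the cubic part, against the definition of a cusp.
  obtain ⟨a, ha⟩ := IsAlgClosed.exists_pow_nat_eq c (n := 2) (by norm_num)
  obtain ⟨b, hb⟩ := IsAlgClosed.exists_pow_nat_eq κ (n := 2) (by norm_num)
  have ha0 : a ≠ 0 := by
    rintro rfl
    exact hc (by simpa using ha.symm)
  have hsq : (C a * l) ^ 2 = (C b * lam) ^ 2 := by
    rw [mul_pow, mul_pow, ← C_pow, ← C_pow, ha, hb, ← hquad, e1]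
  have hb0 : b ≠ 0 := by
    rintro rfl
    rw [C_0, zero_mul, zero_pow two_ne_zero] at hsq
    simp [ha0, hl0] at hsq
  have hu : ∀ a : k, a ≠ 0 → IsUnit (C a : MvPolynomial (Fin 2) k) := fun a ha =>
    (IsUnit.mk0 a ha).map C
  have hll : l ∣ lam := by
    have : l ∣ C b * lam := by
      rcases sq_eq_sq_iff_eq_or_eq_neg.1 hsq with H | H
      · exact ⟨C a, by rw [← H, mul_comm]⟩
      · exact ⟨-C a, by rw [← neg_eq_iff_eq_neg.2 H]; ring⟩
    exact (hu b hb0).dvd_mul_left.1 this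
  exact hdvd (e2 ▸ hll.mul_right _)

/-- In coordinates where the curve is standard, the quartic is a quadratic form in the quadrics.
Degeneracy on all tangent planes leaves the discriminant or rank one, and a single actual cusp
excludes the latter. -/
theorem projectivelyEquivalent_quarticP [IsAlgClosed k] (h2 : (2 : k) ≠ 0) (h3 : (3 : k) ≠ 0)
    {F : MvPolynomial (Fin 4) k} {D : Set (ℙ k (Fin 4 → k))} (hF : F.IsHomogeneous 4)
    (hD : IsTwistedCubic D) (hc : IsCuspidalCurve F D) :
    ProjectivelyEquivalent F (quarticP k) := by
  have : Infinite k := IsAlgClosed.instInfinite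
  obtain ⟨g, rfl⟩ := hD
  obtain ⟨Θ, hΘ, hgen⟩ := hc.exists_generic hF
  obtain ⟨M, hM, hFM⟩ :=
    exists_quadQuartic_of_generic_cusps h2 h3 (compLinear_isHomogeneous hF g) hΘ hgen
  rw [hFM] at hgen
  have hgram := gramDet_eq_zero_of_generic hΘ fun x hx =>
    (hgen x hx).1.gramDet_eq_zero h2 h3 hM (hgen x hx).2
  rcases eq_discriminant_or_rank_one h2 hM hgram with ⟨c, hc0, hdisc⟩ | ⟨κ, v, hv⟩
  · have h27 : (27 : k) ≠ 0 := by simpa [show (27 : k) = 3 ^ 3 by norm_num] using h3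
    refine ⟨(singularCoords h2 h3).symm.trans g, c / 27, div_ne_zero hc0 h27, fun y => ?_⟩
    rw [LinearEquiv.trans_apply, ← eval_compLinear, hFM, hdisc, eval_quarticP_eq_cubicDisc h2 h3]
    field_simp
  · obtain ⟨x, hx⟩ : ∃ x, eval x Θ ≠ 0 := by
      by_contra! H
      exact hΘ (MvPolynomial.funext fun x => by rw [H, map_zero])
    exact absurd (hgen x hx).1 (not_hasCuspAt_of_rank_one hv (quad_cubicPt 1 (x 0)))

end Uniqueness

end CuspidalQuartic

end

theorem theorem2p1 {k : Type*} [Field k] [IsAlgClosed k]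
    (h2 : (2 : k) ≠ 0) (h3 : (3 : k) ≠ 0) :
    -- `P` is the discriminant of the deformed bidouble cover: `-Δ / 16² = P(u, v, a², b²)`
    (∀ (A : Type*) [CommRing A] [Algebra k A] (u v a b : A),
      coverDiscriminant u v a b =
        -16 ^ 2 * MvPolynomial.aeval ![u, v, a ^ 2, b ^ 2] (quarticP k)) ∧
    -- `P` is an irreducible quartic
    (quarticP k).IsHomogeneous 4 ∧ Irreducible (quarticP k) ∧
    -- its singular locus is a twisted cubic, which is a cuspidal curve
    IsTwistedCubic (singularLocus (quarticP k)) ∧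
    IsCuspidalCurve (quarticP k) (singularLocus (quarticP k)) ∧
    -- projective uniqueness among quartic surfaces with a twisted cubic as cuspidal curve
    (∀ (F : MvPolynomial (Fin 4) k) (D : Set (Projectivization k (Fin 4 → k))),
      F ≠ 0 → F.IsHomogeneous 4 → IsTwistedCubic D → IsCuspidalCurve F D →
        ProjectivelyEquivalent F (quarticP k)) ∧
    -- dual surface of a twisted cubic
    (∃ D : Set (Projectivization k (Fin 4 → k)), IsTwistedCubic D ∧
      zeroLocus (quarticP k) = dualSurface D) ∧
    -- tangential developable of its singular curve
    zeroLocus (quarticP k) = tangentialDevelopable (singularLocus (quarticP k)) ∧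
    -- discriminant surface of binary cubic forms
    (∃ φ : (Fin 4 → k) ≃ₗ[k] BinaryCubicForm k,
      Projectivization.map φ.toLinearMap φ.injective '' zeroLocus (quarticP k)
        = discriminantSurface k ∧
      ∃ c : k, c ≠ 0 ∧
        ∀ x, MvPolynomial.eval x (quarticP k) = c * (φ x).toCubic.discr) := by
  exact ⟨fun A _ _ u v a b => coverDiscriminant_eq_aeval_quarticP h2 u v a b,
    quarticP_isHomogeneous, quarticP_irreducible h2 h3,
    ⟨singularCoords h2 h3, singularLocus_quarticP h2 h3⟩, isCuspidalCurve_singularLocus h2 h3,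
    fun _ _ _ hF hD hc => projectivelyEquivalent_quarticP h2 h3 hF hD hc,
    ⟨_, ⟨dualCoords h2, rfl⟩, zeroLocus_eq_dualSurface h2 h3⟩,
    zeroLocus_eq_tangentialDevelopable h2 h3,
    ⟨cubicFormEquiv h2, image_zeroLocus_eq_discriminantSurface h2 h3, -1, by simp, fun x => by
      rw [eval_quarticP h2, toCubic_cubicFormEquiv, neg_one_mul]⟩⟩
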